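/- Let $N\in\mathbb N$. Let $C(\bar O_N)$ be the universal $C^*$-algebra generated by the entries of an $N\times N$ matrix $\bar u=(\bar u_{ij})$, subject to the relations $\bar u_{ij}=\bar u_{ij}^*$, $\bar u\bar u^t=\bar u^t\bar u=1$, distinct entries on the same row or column anticommute, and entries on distinct rows and distinct columns commute. Let $\mathcal O(\bar O_N)\subset C(\bar O_N)$ be the $*$-subalgebra generated by the $\bar u_{ij}$, and let $\mathcal O(O_N)\subset C(O_N)$ be the algebra generated by the coordinates $u_{ij}(g)=g_{ij}$. Representations of $\bar O_N$ are matrices $w\in M_n(\mathcal O(\bar O_N))$ with $\Delta(w_{ij})=\sum_kw_{ik}\otimes w_{kj}$ and $\varepsilon(w_{ij})=\delta_{ij}$, where $\Delta,\varepsilon$ are the algebra morphisms with $\Delta(\bar u_{ij})=\sum_k\bar u_{ik}\otimes\bar u_{kj}$, $\varepsilon(\bar u_{ij})=\delta_{ij}$ (which exist). *Twisting.* Say that $x\in\mathcal O(O_N)$ has bidegree $(S,T)$, with $S,T\subset\{1,\ldots,N\}$, if $x(dge)=\prod_{i\in S}d_i\prod_{j\in T}e_j\,x(g)$ for all diagonal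 sign matrices $d,e$ and all $g\in O_N$, and put $\gamma(S,S')=(-1)^{\#\{(a,b)\in S\times S':a>b\}}$. There is a unique linear isomorphism $\theta:\mathcal O(O_N)\to\mathcal O(\bar O_N)$ such that $\theta(1)=1$, $\theta(u_{ij})=\bar u_{ij}$, and $\theta(x)\theta(y)=\gamma(S,S')\gamma(T,T')\theta(xy)$ for $x,y$ of bidegrees $(S,T),(S',T')$. A matrix $\rho\in M_n(\mathcal O(O_N))$ is a representation of $O_N$ if and only if $\theta(\rho)=(\theta(\rho_{ij}))$ is a representation of $\bar O_N$, and $\theta(\rho\otimes\tau)$ is equivalent to $\theta(\rho)\otimes\theta(\tau)$ for any two such representations $\rho,\tau$ of $O_N$. Thus $\rho\leftrightarrow\theta(\rho)$ is a one-to-one correspondence between the representations of $O_N$ and those of $\bar O_N$, preserving the fusion rules. *Magic representation.* Let $\mathbb Z_2^N=\langle g_1,\ldots,g_N\rangle$, let $\Phi:C^*(\mathbb Z_2^N)\to\mathcal O(\bar O_N)\otimes C^*(\mathbb Z_2^N)$ be the morphism of algebras $g_a\mapsto\sum_b\bar u_{ab}\otimes g_b$, and let $w\in M_{2^N}(\mathcal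 O(\bar O_N))$ be given by $\Psi(\delta_i)=\sum_kw_{ik}\otimes\delta_k$, where $\Psi:C(\mathbb Z_2^N)\to\mathcal O(\bar O_N)\otimes C(\mathbb Z_2^N)$ is obtained from $\Phi$ via the Fourier isomorphism $C(\mathbb Z_2^N)\simeq C^*(\mathbb Z_2^N)$, $\delta_i\mapsto2^{-N}\sum_j(-1)^{\langle i,j\rangle}g_1^{j_1}\cdots g_N^{j_N}$. *Antisymmetric representation.* For $0\le r\le N$ let $O_N$ act by $g^{\otimes r}$ on $X_r=\mathrm{span}(\xi_{i_1\ldots i_r}\mid i_1<\ldots<i_r)\subset(\mathbb C^N)^{\otimes r}$, where $\xi_{i_1\ldots i_r}=\sum_{\sigma\in S_r}\varepsilon(\sigma)e_{i_{\sigma(1)}}\otimes\ldots\otimes e_{i_{\sigma(r)}}$. **Theorem.** The matrix $w$ is a magic unitary (its entries are projections, summing up to $1$ on each row and column) and a representation of $\bar O_N$, and it corresponds to the full antisymmetric representation $\bigoplus_{r=0}^NX_r$ of $O_N$: in a suitable basis, the matrix coefficients of $\bigoplus_rX_r$ are mapped by $\theta$ to the entries of $w$. More precisely, with $g_A=\prod_{a\in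 A}g_a$: 1. For each $r$ the space $\mathrm{span}(g_A:|A|=r)$ is invariant under $\Phi$ (the coefficient of $g_B$ in $\Phi(g_A)$ is $0$ if $|A|\ne|B|$), and the representation $w^{(r)}$ of $\bar O_N$ on it corresponds to $X_r$ in the same sense. 2. With $S_N^A=\{\sigma\in S_N\mid\sigma_{|A^c}=\mathrm{id}\}$, the character of $w$ is $\sum_{r=0}^N\bar\chi_r$, where the character of $w^{(r)}$ is $\bar\chi_r=\sum_{|A|=r}\sum_{\sigma\in S_N^A}\prod_{a\in A}\bar u_{a\sigma(a)}$ (products in increasing order of $a$), the character of $X_r$ is $\chi_r=\sum_{|A|=r}\sum_{\sigma\in S_N^A}\varepsilon(\sigma)\prod_{a\in A}u_{a\sigma(a)}$, and $\theta(\chi_r)=\bar\chi_r$. In fact $\theta\big(\varepsilon(\sigma)\prod_{a\in A}u_{a\sigma(a)}\big)=\prod_{a\in A}\bar u_{a\sigma(a)}$ for any $A\subset\{1,\ldots,N\}$ and any $\sigma\in S_N^A$. -/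

import Mathlib

open scoped ENNReal TensorProduct DirectSum Kronecker

noncomputable section

namespace TwistedOrth

/-! ### The universal C*-algebra `C(Ō_N)` and its dense *-subalgebra -/

/-- The defining relations of `Ō_N` for a square matrix `v` over a *-ring: the entries are
self-adjoint, `v vᵗ = vᵗ v = 1`, distinct entries on the same row or on the same column
anticommute, and entries on distinct rows and distinct columns commute. -/
structure IsTwistedOrthogonal {N : ℕ} {B : Type*} [Ring B] [StarRing B]
    (v : Matrix (Fin N) (Fin N) B) : Prop where
  selfAdjoint : ∀ i j, star (v i j) = v i j
  row_orthogonal : ∀ i j, ∑ k, v i k * v j k = if i = j then 1 else 0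
  col_orthogonal : ∀ i j, ∑ k, v k i * v k j = if i = j then 1 else 0
  row_anticomm : ∀ i j l, j ≠ l → v i j * v i l = -(v i l * v i j)
  col_anticomm : ∀ i k j, i ≠ k → v i j * v k j = -(v k j * v i j)
  comm : ∀ i k j l, i ≠ k → j ≠ l → v i j * v k l = v k l * v i j

/-- A solution of the defining relations of `Ō_N` in some nonzero C*-algebra. -/
structure Solution (N : ℕ) : Type 1 where
  carrier : Type
  [cstar : CStarAlgebra carrier]
  [nontrivial : Nontrivial carrier]
  entry : Matrix (Fin N) (Fin N) carrier
  rel : IsTwistedOrthogonal entry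

instance (N : ℕ) (p : Solution N) : CStarAlgebra p.carrier := p.cstar

instance (N : ℕ) (p : Solution N) : Nontrivial p.carrier := p.nontrivial

/-- The entries of a solution of the relations in a C*-algebra have norm at most `1`. -/
theorem IsTwistedOrthogonal.norm_le_one {N : ℕ} {B : Type*} [CStarAlgebra B]
    {v : Matrix (Fin N) (Fin N) B} (h : IsTwistedOrthogonal v) (i j : Fin N) : ‖v i j‖ ≤ 1 := by
  let : PartialOrder B := CStarAlgebra.spectralOrder B
  let : StarOrderedRing B := CStarAlgebra.spectralOrderedRing B
  have h1 : star (v i j) * v i j ≤ 1 := by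
    have h2 := h.row_orthogonal i i
    rw [if_pos rfl] at h2
    rw [← h2, h.selfAdjoint]
    refine Finset.single_le_sum (f := fun k => v i k * v i k) (fun k _ => ?_) (Finset.mem_univ j)
    have := star_mul_self_nonneg (v i k)
    rwa [h.selfAdjoint] at this
  have h3 : ‖star (v i j) * v i j‖ ≤ 1 :=
    (CStarAlgebra.norm_le_one_iff_of_nonneg _ (star_mul_self_nonneg _)).2 h1
  rw [CStarRing.norm_star_mul_self] at h3
  nlinarith [norm_nonneg (v i j)]

/-- The C*-algebra of bounded families indexed by all solutions of the relations. -/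
abbrev Ambient (N : ℕ) : Type 1 := lp (fun p : Solution N => p.carrier) ∞

instance (N : ℕ) : CStarAlgebra (Ambient N) where

/-- The tautological matrix, whose component at a solution is that solution. -/
def ambientCoord (N : ℕ) (i j : Fin N) : Ambient N :=
  ⟨fun p => p.entry i j, memℓp_infty ⟨1, by
    rintro _ ⟨p, rfl⟩
    exact p.rel.norm_le_one i j⟩⟩

/-- `C(Ō_N)`, the universal C*-algebra given by the relations `IsTwistedOrthogonal`: the closed
*-algebra generated by the tautological matrix. -/
def cObar (N : ℕ) : StarSubalgebra ℂ (Ambient N) :=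
  (StarAlgebra.adjoin ℂ (Set.range fun p : Fin N × Fin N =>
    ambientCoord N p.1 p.2)).topologicalClosure

instance (N : ℕ) : IsClosed (cObar N : Set (Ambient N)) :=
  StarSubalgebra.isClosed_topologicalClosure _

/-- `C(Ō_N)` as a type. -/
def CObar (N : ℕ) : Type 1 := cObar N

instance (N : ℕ) : CStarAlgebra (CObar N) := inferInstanceAs (CStarAlgebra (cObar N))

/-- The standard coordinates `u_{ij} ∈ C(Ō_N)`. -/
def cCoord (N : ℕ) (i j : Fin N) : CObar N :=
  ⟨ambientCoord N i j, StarSubalgebra.le_topologicalClosure _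
    (StarAlgebra.subset_adjoin ℂ _ ⟨(i, j), rfl⟩)⟩

/-- The universal property of `C(Ō_N)`: for any solution of the relations in a C*-algebra there
is a *-morphism from `C(Ō_N)` which maps the standard coordinates to that solution. -/
def toSolution {N : ℕ} (p : Solution N) : CObar N →⋆ₐ[ℂ] p.carrier where
  toFun x := x.1 p
  map_one' := rfl
  map_mul' _ _ := rfl
  map_zero' := rfl
  map_add' _ _ := rfl
  commutes' _ := rfl
  map_star' _ := rfl

theorem toSolution_cCoord {N : ℕ} (p : Solution N) (i j : Fin N) :
    toSolution p (cCoord N i j) = p.entry i j := rfl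

theorem ext_toSolution {N : ℕ} {x y : CObar N}
    (h : ∀ p : Solution N, toSolution p x = toSolution p y) : x = y := by
  apply Subtype.ext
  apply lp.ext
  funext p
  exact h p

theorem isTwistedOrthogonal_cCoord (N : ℕ) :
    IsTwistedOrthogonal (Matrix.of (cCoord N)) where
  selfAdjoint i j := ext_toSolution fun p => by
    exact p.rel.selfAdjoint i j
  row_orthogonal i j := ext_toSolution fun p => by
    have h := p.rel.row_orthogonal i j
    split_ifs at h ⊢ <;> simpa [toSolution_cCoord] using h
  col_orthogonal i j := ext_toSolution fun p => by
    have h := p.rel.col_orthogonal i j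
    split_ifs at h ⊢ <;> simpa [toSolution_cCoord] using h
  row_anticomm i j l h := ext_toSolution fun p => by
    simpa [toSolution_cCoord] using p.rel.row_anticomm i j l h
  col_anticomm i k j h := ext_toSolution fun p => by
    simpa [toSolution_cCoord] using p.rel.col_anticomm i k j h
  comm i k j l h h' := ext_toSolution fun p => by
    simpa [toSolution_cCoord] using p.rel.comm i k j l h h'

/-- The *-algebra of representative functions on `Ō_N`: the dense *-subalgebra of `C(Ō_N)`
generated by the standard coordinates. -/
def polObar (N : ℕ) : StarSubalgebra ℂ (CObar N) :=
  StarAlgebra.adjoin ℂ (Set.range fun p : Fin N × Fin N => cCoord N p.1 p.2)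

/-- The algebra `polObar N` as a type. -/
abbrev PolObar (N : ℕ) : Type 1 := polObar N

/-- The standard coordinates `u_{ij}` of `Ō_N`. -/
def ubar (N : ℕ) : Matrix (Fin N) (Fin N) (PolObar N) := Matrix.of fun i j =>
  ⟨cCoord N i j, StarAlgebra.subset_adjoin ℂ _ ⟨(i, j), rfl⟩⟩

theorem isTwistedOrthogonal_ubar (N : ℕ) : IsTwistedOrthogonal (ubar N) where
  selfAdjoint i j := Subtype.ext ((isTwistedOrthogonal_cCoord N).selfAdjoint i j)
  row_orthogonal i j := by
    apply Subtype.ext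
    have h := (isTwistedOrthogonal_cCoord N).row_orthogonal i j
    rw [AddSubmonoidClass.coe_finsetSum]
    refine Eq.trans h ?_
    split_ifs <;> rfl
  col_orthogonal i j := by
    apply Subtype.ext
    have h := (isTwistedOrthogonal_cCoord N).col_orthogonal i j
    rw [AddSubmonoidClass.coe_finsetSum]
    refine Eq.trans h ?_
    split_ifs <;> rfl
  row_anticomm i j l h := Subtype.ext ((isTwistedOrthogonal_cCoord N).row_anticomm i j l h)
  col_anticomm i k j h := Subtype.ext ((isTwistedOrthogonal_cCoord N).col_anticomm i k j h)
  comm i k j l h h' := Subtype.ext ((isTwistedOrthogonal_cCoord N).comm i k j l h h')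

/-- `Δ` is the comultiplication of `Ō_N`: `Δ(u_{ij}) = ∑ₖ u_{ik} ⊗ u_{kj}`. -/
def IsComul {N : ℕ} (Δ : PolObar N →ₐ[ℂ] PolObar N ⊗[ℂ] PolObar N) : Prop :=
  ∀ i j, Δ (ubar N i j) = ∑ k, ubar N i k ⊗ₜ[ℂ] ubar N k j

/-- `ε` is the counit of `Ō_N`: `ε(u_{ij}) = δ_{ij}`. -/
def IsCounit {N : ℕ} (ε : PolObar N →ₐ[ℂ] ℂ) : Prop :=
  ∀ i j, ε (ubar N i j) = if i = j then 1 else 0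

/-- Finite dimensional representations of the quantum group `Ō_N`, in matrix form. -/
structure IsCorep {N : ℕ} (Δ : PolObar N →ₐ[ℂ] PolObar N ⊗[ℂ] PolObar N)
    (ε : PolObar N →ₐ[ℂ] ℂ) {n : Type*} [Fintype n] [DecidableEq n]
    (w : Matrix n n (PolObar N)) : Prop where
  comul : ∀ i j, Δ (w i j) = ∑ k, w i k ⊗ₜ[ℂ] w k j
  counit : ∀ i j, ε (w i j) = if i = j then 1 else 0

/-- Equivalence of matrix representations of `Ō_N`: conjugation by an invertible scalar
matrix. -/
def CorepEquiv {N : ℕ} {n : Type*} [Fintype n] [DecidableEq n]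
    (w w' : Matrix n n (PolObar N)) : Prop :=
  ∃ T : Matrix n n ℂ, IsUnit T ∧
    T.map (algebraMap ℂ (PolObar N)) * w = w' * T.map (algebraMap ℂ (PolObar N))

/-- Magic unitaries: the entries are projections, summing up to `1` on each row and column. -/
structure IsMagicUnitary {B : Type*} [Ring B] [StarRing B] {n : Type*} [Fintype n]
    (w : Matrix n n B) : Prop where
  selfAdjoint : ∀ i j, star (w i j) = w i j
  idempotent : ∀ i j, w i j * w i j = w i j
  row_sum : ∀ i, ∑ j, w i j = 1
  col_sum : ∀ j, ∑ i, w i j = 1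

/-! ### The action of `Ō_N` on the hypercube -/

/-- The group `ℤ₂^N`. -/
abbrev Cube (N : ℕ) : Type := Fin N → Multiplicative (ZMod 2)

/-- The element `∏_{a ∈ A} g_a` of `ℤ₂^N`, where `g_1, …, g_N` are the standard generators. -/
def cubeElt {N : ℕ} (A : Finset (Fin N)) : Cube N :=
  fun a => Multiplicative.ofAdd (if a ∈ A then 1 else 0)

/-- The element `∑_b u_{ab} ⊗ g_b`. -/
def coactGen (N : ℕ) (a : Fin N) : PolObar N ⊗[ℂ] MonoidAlgebra ℂ (Cube N) :=
  ∑ b, ubar N a b ⊗ₜ[ℂ] MonoidAlgebra.of ℂ (Cube N) (cubeElt {b})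

theorem cubeElt_mul_self {N : ℕ} (b : Fin N) : cubeElt {b} * cubeElt {b} = 1 := by
  funext a
  change Multiplicative.ofAdd ((if a ∈ ({b} : Finset (Fin N)) then (1 : ZMod 2) else 0) +
    (if a ∈ ({b} : Finset (Fin N)) then (1 : ZMod 2) else 0)) = 1
  split_ifs
  · rfl
  · rfl

theorem coactGen_mul (N : ℕ) (a c : Fin N) : coactGen N a * coactGen N c =
    ∑ b, ∑ d, (ubar N a b * ubar N c d) ⊗ₜ[ℂ]
      MonoidAlgebra.of ℂ (Cube N) (cubeElt {b} * cubeElt {d}) := by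
  simp only [coactGen, Finset.sum_mul, Finset.mul_sum, Algebra.TensorProduct.tmul_mul_tmul,
    map_mul]
  exact Finset.sum_comm

/-- Splitting of `coactGen_mul` into its diagonal and off-diagonal part. -/
theorem coactGen_mul' (N : ℕ) (a c : Fin N) : coactGen N a * coactGen N c =
    (if a = c then 1 else 0) + ∑ b, ∑ d, if b = d then 0 else (ubar N a b * ubar N c d) ⊗ₜ[ℂ]
      MonoidAlgebra.of ℂ (Cube N) (cubeElt {b} * cubeElt {d}) := by
  have h : ∀ b d, (ubar N a b * ubar N c d) ⊗ₜ[ℂ]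
      MonoidAlgebra.of ℂ (Cube N) (cubeElt {b} * cubeElt {d}) =
      (if b = d then (ubar N a b * ubar N c b) ⊗ₜ[ℂ] (1 : MonoidAlgebra ℂ (Cube N)) else 0) +
      (if b = d then 0 else (ubar N a b * ubar N c d) ⊗ₜ[ℂ]
        MonoidAlgebra.of ℂ (Cube N) (cubeElt {b} * cubeElt {d})) := by
    intro b d
    split_ifs with h
    · subst h
      rw [cubeElt_mul_self, map_one, add_zero]
    · rw [zero_add]
  rw [coactGen_mul]
  rw [Finset.sum_congr rfl fun b _ => Finset.sum_congr rfl fun d _ => h b d]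
  simp only [Finset.sum_add_distrib]
  congr 1
  simp only [Finset.sum_ite_eq, Finset.mem_univ, if_true]
  rw [← TensorProduct.sum_tmul, (isTwistedOrthogonal_ubar N).row_orthogonal]
  split_ifs
  · rfl
  · exact TensorProduct.zero_tmul _ _

theorem coactGen_mul_self (N : ℕ) (a : Fin N) : coactGen N a * coactGen N a = 1 := by
  rw [coactGen_mul', if_pos rfl, add_eq_left]
  set f : Fin N → Fin N → PolObar N ⊗[ℂ] MonoidAlgebra ℂ (Cube N) := fun b d =>
    if b = d then 0 else (ubar N a b * ubar N a d) ⊗ₜ[ℂ]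
      MonoidAlgebra.of ℂ (Cube N) (cubeElt {b} * cubeElt {d}) with hf
  have hneg : ∀ b d, f b d = -f d b := by
    intro b d
    simp only [hf]
    by_cases h : b = d
    · simp [h]
    · rw [if_neg h, if_neg (Ne.symm h), (isTwistedOrthogonal_ubar N).row_anticomm a b d h,
        mul_comm (cubeElt {b})]
      exact TensorProduct.neg_tmul _ _
  have h1 : ∑ b, ∑ d, f b d = -∑ b, ∑ d, f b d := by
    conv_lhs => rw [Finset.sum_comm]
    simp only [← Finset.sum_neg_distrib]
    exact Finset.sum_congr rfl fun b _ => Finset.sum_congr rfl fun d _ => hneg d b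
  have h2 : (2 : ℂ) • ∑ b, ∑ d, f b d = 0 := by
    rw [two_smul]
    nth_rewrite 2 [h1]
    exact add_neg_cancel _
  have h3 := congrArg (fun x => (2 : ℂ)⁻¹ • x) h2
  simp only [smul_zero] at h3
  rwa [smul_smul, inv_mul_cancel₀ two_ne_zero, one_smul] at h3

theorem coactGen_commute (N : ℕ) (a c : Fin N) : Commute (coactGen N a) (coactGen N c) := by
  by_cases hac : a = c
  · rw [hac]
  · rw [commute_iff_eq, coactGen_mul', coactGen_mul', if_neg hac, if_neg (Ne.symm hac)]
    congr 1
    rw [Finset.sum_comm]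
    refine Finset.sum_congr rfl fun b _ => Finset.sum_congr rfl fun d _ => ?_
    by_cases h : b = d
    · simp [h]
    · rw [if_neg h, if_neg (Ne.symm h),
        (isTwistedOrthogonal_ubar N).comm a c d b hac (Ne.symm h), mul_comm (cubeElt {b})]

/-- The morphism `ℤ₂ → (PolObar N ⊗ ℂ[ℤ₂^N])` which sends the generator to `∑_b u_{ab} ⊗ g_b`. -/
def coactHom (N : ℕ) (a : Fin N) :
    Multiplicative (ZMod 2) →* PolObar N ⊗[ℂ] MonoidAlgebra ℂ (Cube N) where
  toFun x := coactGen N a ^ (Multiplicative.toAdd x).val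
  map_one' := rfl
  map_mul' x y := by
    rw [← pow_add, toAdd_mul, ZMod.val_add]
    have h2 : coactGen N a ^ 2 = 1 := by rw [pow_two, coactGen_mul_self]
    exact (pow_eq_pow_mod _ h2).symm

theorem coactHom_commute (N : ℕ) :
    Pairwise fun a c => ∀ x y, Commute (coactHom N a x) (coactHom N c y) :=
  fun a c _ _ _ => (coactGen_commute N a c).pow_pow _ _

/-- The coaction `Φ : C*(ℤ₂^N) → C(Ō_N) ⊗ C*(ℤ₂^N)`, the morphism of algebras given by
`g_a ↦ ∑_b u_{ab} ⊗ g_b`. -/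
def coaction (N : ℕ) :
    MonoidAlgebra ℂ (Cube N) →ₐ[ℂ] PolObar N ⊗[ℂ] MonoidAlgebra ℂ (Cube N) :=
  MonoidAlgebra.lift ℂ _ (Cube N)
    (MonoidHom.noncommPiCoprod (coactHom N) (coactHom_commute N))

theorem coaction_gen (N : ℕ) (a : Fin N) :
    coaction N (MonoidAlgebra.of ℂ (Cube N) (cubeElt {a})) =
      ∑ b, ubar N a b ⊗ₜ[ℂ] MonoidAlgebra.of ℂ (Cube N) (cubeElt {b}) := by
  have h : (cubeElt {a} : Cube N) = Pi.mulSingle a (Multiplicative.ofAdd 1) := by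
    funext c
    by_cases hc : c = a
    · subst hc; simp [cubeElt]
    · simp [cubeElt, hc]
  rw [coaction, MonoidAlgebra.lift_of, h, MonoidHom.noncommPiCoprod_mulSingle]
  exact pow_one _

/-- The sign `(-1)^{⟨i,j⟩}`, for `i, j ∈ ℤ₂^N`. -/
def pairing {N : ℕ} (i j : Cube N) : ℂ :=
  (-1) ^ ∑ k, (Multiplicative.toAdd (i k)).val * (Multiplicative.toAdd (j k)).val

/-- The Fourier transform `α : C(ℤ₂^N) → C*(ℤ₂^N)`,
`δ_i ↦ 2^{-N} ∑_j (-1)^{⟨i,j⟩} g^j`. -/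
def fourier (N : ℕ) : (Cube N → ℂ) →ₗ[ℂ] MonoidAlgebra ℂ (Cube N) where
  toFun f := ∑ i, ∑ j, (f i * ((2 : ℂ) ^ N)⁻¹ * pairing i j) • MonoidAlgebra.of ℂ (Cube N) j
  map_add' f f' := by simp only [Pi.add_apply, add_mul, add_smul, Finset.sum_add_distrib]
  map_smul' c f := by
    simp only [Pi.smul_apply, smul_eq_mul, mul_assoc, mul_smul, Finset.smul_sum, RingHom.id_apply]

/-- The inverse Fourier transform `β : C*(ℤ₂^N) → C(ℤ₂^N)`, `g^i ↦ ∑_j (-1)^{⟨i,j⟩} δ_j`. -/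
def fourierInv (N : ℕ) : MonoidAlgebra ℂ (Cube N) →ₗ[ℂ] (Cube N → ℂ) where
  toFun x := fun j => ∑ i, x.coeff i * pairing i j
  map_add' x y := by
    funext j
    simp [add_mul, Finset.sum_add_distrib]
  map_smul' c x := by
    funext j
    simp [mul_assoc, Finset.mul_sum]

/-- The action `Ψ = (id ⊗ β) Φ α : C(ℤ₂^N) → C(Ō_N) ⊗ C(ℤ₂^N)` on the hypercube. -/
def cubeAction (N : ℕ) : (Cube N → ℂ) →ₗ[ℂ] PolObar N ⊗[ℂ] (Cube N → ℂ) :=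
  (fourierInv N).lTensor (PolObar N) ∘ₗ (coaction N).toLinearMap ∘ₗ fourier N

/-- The magic representation of `Ō_N` on the `2^N` vertices of the hypercube: the matrix
`w` given by `Ψ(δ_i) = ∑_k w_{ik} ⊗ δ_k`. -/
def magic (N : ℕ) : Matrix (Cube N) (Cube N) (PolObar N) := Matrix.of fun i k =>
  TensorProduct.rid ℂ (PolObar N)
    ((LinearMap.proj k : (Cube N → ℂ) →ₗ[ℂ] ℂ).lTensor (PolObar N)
      (cubeAction N (Pi.single i 1)))

/-- The coefficient of `g_B` in `Φ(g_A)`, where `g_A = ∏_{a ∈ A} g_a`. -/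
def coactCoeff {N : ℕ} (A B : Finset (Fin N)) : PolObar N :=
  TensorProduct.rid ℂ (PolObar N)
    (((Finsupp.lapply (cubeElt B) : (Cube N →₀ ℂ) →ₗ[ℂ] ℂ) ∘ₗ
        (MonoidAlgebra.coeffLinearEquiv ℂ).toLinearMap).lTensor (PolObar N)
      (coaction N (MonoidAlgebra.of ℂ (Cube N) (cubeElt A))))

/-- The degree `r` component of the magic representation, acting on
`span(g_A : |A| = r) ⊂ C*(ℤ₂^N)`. -/
def magicComponent (N r : ℕ) : Matrix {A : Finset (Fin N) // A.card = r}
    {A : Finset (Fin N) // A.card = r} (PolObar N) :=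
  Matrix.of fun A B => coactCoeff A.1 B.1

/-- The permutations `σ ∈ S_N` which are the identity outside of `A`. -/
def permsOn {N : ℕ} (A : Finset (Fin N)) : Finset (Equiv.Perm (Fin N)) :=
  Finset.univ.filter fun σ => ∀ a, a ∉ A → σ a = a

/-- The product `∏_{a ∈ A} u_{aσ(a)}` in `C(Ō_N)`, taken in increasing order of `a`. -/
def orderedProd {N : ℕ} (A : Finset (Fin N)) (σ : Equiv.Perm (Fin N)) : PolObar N :=
  ((A.sort (· ≤ ·)).map fun a => ubar N a (σ a)).prod

/-- `∑_{|A| = r} ∑_{σ ∈ S_N^A} ∏_{a ∈ A} u_{aσ(a)}`, in `C(Ō_N)`. -/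
def chiBar (N r : ℕ) : PolObar N :=
  ∑ A ∈ Finset.univ.powersetCard r, ∑ σ ∈ permsOn A, orderedProd A σ

/-! ### The orthogonal group and its antisymmetric representations -/

/-- The orthogonal group `O_N`. -/
abbrev O (N : ℕ) : Type := Matrix.orthogonalGroup (Fin N) ℝ

/-- The standard coordinates of `O_N`, as continuous functions. -/
def coord (N : ℕ) (i j : Fin N) : C(O N, ℂ) :=
  ⟨fun g => ((g : Matrix (Fin N) (Fin N) ℝ) i j : ℂ),
    Complex.continuous_ofReal.comp (continuous_subtype_val.matrix_elem i j)⟩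

/-- The algebra of representative functions on `O_N`, generated by the standard coordinates. -/
def polO (N : ℕ) : Subalgebra ℂ C(O N, ℂ) :=
  Algebra.adjoin ℂ (Set.range fun p : Fin N × Fin N => coord N p.1 p.2)

/-- The algebra `polO N` as a type. -/
abbrev PolO (N : ℕ) : Type := polO N

/-- The standard coordinates `u_{ij}` of `O_N`. -/
def uO (N : ℕ) : Matrix (Fin N) (Fin N) (PolO N) := Matrix.of fun i j =>
  ⟨coord N i j, Algebra.subset_adjoin ⟨(i, j), rfl⟩⟩

/-- The value of a representative function at a point of `O_N`. -/
def evalO {N : ℕ} (x : PolO N) (g : O N) : ℂ := (x : C(O N, ℂ)) g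

/-- Finite dimensional representations of `O_N`, in matrix form. -/
structure IsRep {N : ℕ} {n : Type*} [Fintype n] [DecidableEq n]
    (ρ : Matrix n n (PolO N)) : Prop where
  mul : ∀ g h i j, evalO (ρ i j) (g * h) = ∑ k, evalO (ρ i k) g * evalO (ρ k j) h
  one : ∀ i j, evalO (ρ i j) 1 = if i = j then 1 else 0

/-- `∑_{|A| = r} ∑_{σ ∈ S_N^A} ε(σ) ∏_{a ∈ A} u_{aσ(a)}`, in `C(O_N)`. -/
def chiO (N r : ℕ) : PolO N :=
  ∑ A ∈ Finset.univ.powersetCard r, ∑ σ ∈ permsOn A,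
    ((Equiv.Perm.sign σ : ℤ) : ℂ) • ∏ a ∈ A, uO N a (σ a)

/-- The tensor power `(ℂ^N)^{⊗ r}`. -/
abbrev TensorPow (N r : ℕ) : Type := ⨂[ℂ] _ : Fin r, (Fin N → ℂ)

/-- The linear map of `ℂ^N` given by `g ∈ O_N`. -/
def stdAct {N : ℕ} (g : O N) : (Fin N → ℂ) →ₗ[ℂ] (Fin N → ℂ) :=
  Matrix.toLin' ((g : Matrix (Fin N) (Fin N) ℝ).map Complex.ofReal)

theorem stdAct_one {N : ℕ} : stdAct (1 : O N) = LinearMap.id := by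
  simp [stdAct, Matrix.map_one]

theorem stdAct_mul {N : ℕ} (g h : O N) : stdAct (g * h) = stdAct g ∘ₗ stdAct h := by
  rw [stdAct, stdAct, stdAct, ← Matrix.toLin'_mul]
  congr 1
  exact Matrix.map_mul (f := Complex.ofRealHom)

/-- The action `g ↦ g^{⊗ r}` of `O_N` on `(ℂ^N)^{⊗ r}`. -/
def tensorRep (N r : ℕ) : Representation ℂ (O N) (TensorPow N r) where
  toFun g := PiTensorProduct.map fun _ => stdAct g
  map_one' := by
    simp only [stdAct_one]
    exact PiTensorProduct.map_id
  map_mul' g h := by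
    simp only [stdAct_mul]
    exact PiTensorProduct.map_comp _ _

/-- The antisymmetric vector
`ξ_{i_1 … i_r} = ∑_{σ ∈ S_r} ε(σ) e_{i_{σ(1)}} ⊗ … ⊗ e_{i_{σ(r)}}`. -/
def xi {N r : ℕ} (i : Fin r → Fin N) : TensorPow N r :=
  ∑ σ : Equiv.Perm (Fin r), ((Equiv.Perm.sign σ : ℤ) : ℂ) •
    PiTensorProduct.tprod ℂ fun k => (Pi.single (i (σ k)) 1 : Fin N → ℂ)

/-- The space `X_r = span(ξ_{i_1 … i_r} | i_1 < … < i_r)` of antisymmetric vectors. -/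
def antisym (N r : ℕ) : Submodule ℂ (TensorPow N r) :=
  Submodule.span ℂ (Set.range fun i : Fin r ↪o Fin N => xi i)

/-- The antisymmetrization of simple tensors, as an alternating map. -/
def alt (N r : ℕ) : (Fin N → ℂ) [⋀^Fin r]→ₗ[ℂ] TensorPow N r :=
  MultilinearMap.alternatization (PiTensorProduct.tprod ℂ)

theorem alt_apply {N r : ℕ} (v : Fin r → Fin N → ℂ) : alt N r v =
    ∑ σ : Equiv.Perm (Fin r), ((Equiv.Perm.sign σ : ℤ) : ℂ) •
      PiTensorProduct.tprod ℂ fun k => v (σ k) := by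
  rw [alt, MultilinearMap.alternatization_apply]
  refine Finset.sum_congr rfl fun σ _ => ?_
  rcases Int.units_eq_one_or (Equiv.Perm.sign σ) with h | h
  · rw [h]
    simp
  · rw [h]
    simp only [Units.neg_smul, one_smul, Units.val_neg, Units.val_one, Int.cast_neg, Int.cast_one]
    exact (neg_one_smul ℂ _).symm

theorem xi_eq_alt {N r : ℕ} (i : Fin r → Fin N) :
    xi i = alt N r fun k => Pi.single (i k) 1 := by
  rw [alt_apply, xi]

theorem xi_mem {N r : ℕ} (i : Fin r → Fin N) : xi i ∈ antisym N r := by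
  by_cases hi : Function.Injective i
  · have hs : StrictMono (i ∘ Tuple.sort i) :=
      (Tuple.monotone_sort i).strictMono_of_injective (hi.comp (Tuple.sort i).injective)
    have hmem : xi (i ∘ Tuple.sort i) ∈ antisym N r :=
      Submodule.subset_span ⟨OrderEmbedding.ofStrictMono _ hs, rfl⟩
    have hp := (alt N r).map_perm (fun k => (Pi.single (i k) 1 : Fin N → ℂ)) (Tuple.sort i)
    have h2 : xi (i ∘ Tuple.sort i) = Equiv.Perm.sign (Tuple.sort i) • xi i := by
      rw [xi_eq_alt, xi_eq_alt, ← hp]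
      rfl
    rw [h2] at hmem
    rcases Int.units_eq_one_or (Equiv.Perm.sign (Tuple.sort i)) with h | h <;>
      rw [h] at hmem
    · simpa using hmem
    · simpa using hmem
  · rw [Function.not_injective_iff] at hi
    obtain ⟨a, b, hab, hne⟩ := hi
    rw [xi_eq_alt, (alt N r).map_eq_zero_of_eq _ (by rw [hab]) hne]
    exact Submodule.zero_mem _

theorem alt_mem {N r : ℕ} (v : Fin r → Fin N → ℂ) : alt N r v ∈ antisym N r := by
  have hv : v = fun k => ∑ j, v k j • (Pi.single j 1 : Fin N → ℂ) := by
    funext k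
    exact pi_eq_sum_univ' (v k)
  have hs := (alt N r).toMultilinearMap.map_sum
    (fun k j => v k j • (Pi.single j 1 : Fin N → ℂ))
  rw [hv]
  refine (congrArg (· ∈ antisym N r) hs).mpr (Submodule.sum_mem _ fun i _ => ?_)
  rw [MultilinearMap.map_smul_univ]
  refine Submodule.smul_mem _ _ ?_
  have := xi_mem i
  rwa [xi_eq_alt] at this

theorem tensorRep_mem {N r : ℕ} (g : O N) {x : TensorPow N r} (hx : x ∈ antisym N r) :
    tensorRep N r g x ∈ antisym N r := by
  induction hx using Submodule.span_induction with
  | mem x h =>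
    obtain ⟨i, rfl⟩ := h
    have : tensorRep N r g (xi i) = alt N r fun k => stdAct g (Pi.single (i k) 1) := by
      rw [alt_apply, xi, map_sum]
      refine Finset.sum_congr rfl fun σ _ => ?_
      rw [map_smul]
      congr 1
      exact PiTensorProduct.map_tprod _ _
    rw [this]
    exact alt_mem _
  | zero => rw [map_zero]; exact Submodule.zero_mem _
  | add x y _ _ hx hy => rw [map_add]; exact Submodule.add_mem _ hx hy
  | smul c x _ hx => rw [map_smul]; exact Submodule.smul_mem _ _ hx

/-- The `r`-th antisymmetric representation of `O_N`, on the space `X_r`. -/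
def antisymRep (N r : ℕ) : Representation ℂ (O N) (antisym N r) where
  toFun g := (tensorRep N r g).restrict fun _ hx => tensorRep_mem g hx
  map_one' := by
    ext x
    simp
  map_mul' g h := by
    ext x
    simp

/-- The full antisymmetric representation `⊕_{r=0}^N X_r` of `O_N`. -/
def fullAntisymRep (N : ℕ) :
    Representation ℂ (O N) (⨁ r : Fin (N + 1), antisym N (r : ℕ)) :=
  Representation.directSum fun r : Fin (N + 1) => antisymRep N (r : ℕ)

/-! ### The twisting correspondence -/

/-- The diagonal matrix with given entries `±1`, as an element of `O_N`. -/
def signDiag {N : ℕ} (d : Fin N → ℤˣ) : O N :=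
  ⟨Matrix.diagonal fun i => ((d i : ℤ) : ℝ), by
    rw [Matrix.mem_orthogonalGroup_iff, Matrix.diagonal_transpose, Matrix.diagonal_mul_diagonal,
      ← Matrix.diagonal_one]
    congr 1
    funext i
    rcases Int.units_eq_one_or (d i) with h | h <;> simp [h]⟩

/-- `x` has bidegree `(S, T)` for the left and right translations by the subgroup
`ℤ₂^N ⊂ O_N` of diagonal sign matrices, whose dual group is identified with the set of subsets
of `{1, …, N}`. For instance `u_{ij}` has bidegree `({i}, {j})`. -/
def HasBidegree {N : ℕ} (S T : Finset (Fin N)) (x : PolO N) : Prop :=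
  ∀ (d e : Fin N → ℤˣ) (g : O N), evalO x (signDiag d * g * signDiag e) =
    (∏ i ∈ S, (((d i : ℤ)) : ℂ)) * (∏ j ∈ T, (((e j : ℤ)) : ℂ)) * evalO x g

/-- The bicharacter (in particular, 2-cocycle) on the dual of `ℤ₂^N` with value `-1` on a pair
of generators `(a, b)` with `a > b`, and `1` on the other pairs of generators. -/
def cocycle {N : ℕ} (S S' : Finset (Fin N)) : ℂ :=
  (-1) ^ ((S ×ˢ S').filter fun p => p.2 < p.1).card

/-- `θ` identifies `Ō_N` with the cocycle twist of `O_N` by the bicharacter `cocycle` of the dual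
of the diagonal subgroup `ℤ₂^N ⊂ O_N`: it matches the coordinates, and turns the product of
`PolO N`, deformed by the cocycle on both sides, into the product of `PolObar N`. -/
structure IsTwist {N : ℕ} (θ : PolO N ≃ₗ[ℂ] PolObar N) : Prop where
  map_one : θ 1 = 1
  map_coord : ∀ i j, θ (uO N i j) = ubar N i j
  map_mul : ∀ (S T S' T' : Finset (Fin N)) (x y : PolO N),
    HasBidegree S T x → HasBidegree S' T' y →
      θ x * θ y = (cocycle S S' * cocycle T T') • θ (x * y)

/-- The representation `ρ` of `O_N` and the matrix representation `w` of `Ō_N` correspond to each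
other via `θ`: in a suitable basis, the matrix coefficients of `ρ` are mapped by `θ` to the
entries of `w`. -/
def Corresponds {N : ℕ} (θ : PolO N ≃ₗ[ℂ] PolObar N) {V : Type*} [AddCommMonoid V] [Module ℂ V]
    (ρ : Representation ℂ (O N) V) {n : Type*} [Fintype n] [DecidableEq n]
    (w : Matrix n n (PolObar N)) : Prop :=
  ∃ (b : Module.Basis n ℂ V) (c : Matrix n n (PolO N)),
    (∀ g i j, LinearMap.toMatrix b b (ρ g) i j = evalO (c i j) g) ∧ c.map θ = w

end TwistedOrth

end

open TwistedOrth

/-! Everything rests on one device. Take the twisted group algebra of the dual of `ℤ₂^N × ℤ₂^N`,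
with basis `e_p` and `e_p e_q = bicocycle p q • e_{p+q}`, and replace each entry `x_{ij}` of a
matrix by `x_{ij} ⊗ e_{({i},{j})}` (`twistEntry`). Exchanging two such basis elements produces one
sign if the row indices differ and one if the column indices differ. The twist therefore turns the
relations of `Ō_N` into those of an orthogonal matrix with commuting self-adjoint entries, and
conversely. A word in the twisted entries is the untwisted word up to `wordSign`.

Hence the words in `u` and the signed words in `ū` satisfy the same linear relations. In one
direction, the twist of `ū` generates a commutative C*-algebra, whose characters are points of `O_N`
by Gelfand theory. In the other, the twist of any `g ∈ O_N` is a solution of the relations of `Ō_N`.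
This gives `θ`, namely `theta`. It satisfies the cocycle rule because words are bihomogeneous and a
bihomogeneous element is, by averaging over sign matrices, a combination of words of its own
bidegree.

Through `θ`, points of `O_N` become linear forms `evalBar` which separate `PolObar N`, and pairs of
points separate its tensor square. The sign of the middle index in `Δ` of a word is squared, so `Δ`
is dual to the product of `O_N`, and representations match. For tensor products, a representation is
cut by the isotypic projections `P_S` of the sign matrices, and `∑ γ(S,T) P_S ⊗ Q_T` intertwines the
two sides.

For the magic representation, the product `g_A` does not depend on the order of its factors.
Averaging `Φ(g_A)` over the `r!` orderings of `A`, the signs of `θ` antisymmetrise the words, so the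
coefficient of `g_B` is `θ` of the `A × B` minor (`coactCoeff_eq_theta_minor`). Minors are the
matrix coefficients of `X_r` in the basis `ξ`, and `w` is the Fourier conjugate of the matrix of all
these coefficients. The entries of `w` are projections because each is the image, under a morphism
of algebras, of the idempotent corresponding to `δ_i`. The character formulas are the Leibniz
expansions of the principal minors. -/

open scoped symmDiff

namespace TwistedOrth

/-! ### Signs -/

/-- The value of the bicharacter `cocycle` on a pair of generators. -/
noncomputable def ordSign {N : ℕ} (a b : Fin N) : ℂ := if b < a then -1 else 1

theorem ordSign_mul_self {N : ℕ} (a b : Fin N) : ordSign a b * ordSign a b = 1 := by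
  unfold ordSign; split_ifs <;> norm_num

theorem ordSign_self {N : ℕ} (a : Fin N) : ordSign a a = 1 := by simp [ordSign]

theorem ordSign_swap {N : ℕ} {a b : Fin N} (h : a ≠ b) : ordSign a b = -ordSign b a := by
  unfold ordSign
  rcases lt_or_gt_of_ne h with h | h
  · simp [h, h.le]
  · simp [h, h.le]

theorem cocycle_eq_prod {N : ℕ} (S T : Finset (Fin N)) :
    cocycle S T = ∏ a ∈ S, ∏ b ∈ T, ordSign a b := by
  rw [← Finset.prod_product', cocycle]
  simp [ordSign, Finset.prod_ite]

/-- The elements of `S ∩ T` occur twice on the right, where their values square to `1`. This is what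
makes `cocycle` and `signChar` multiplicative for symmetric differences. -/
theorem prod_symmDiff_of_mul_self {α M : Type*} [DecidableEq α] [CommMonoid M] {f : α → M}
    (hf : ∀ a, f a * f a = 1) (S T : Finset α) :
    ∏ a ∈ S ∆ T, f a = (∏ a ∈ S, f a) * ∏ a ∈ T, f a := by
  have h1 := Finset.prod_inter_mul_prod_sdiff S T f
  have h2 := Finset.prod_inter_mul_prod_sdiff T S f
  have h3 : (∏ a ∈ S ∩ T, f a) * ∏ a ∈ S ∩ T, f a = 1 := by
    rw [← Finset.prod_mul_distrib]
    exact Finset.prod_eq_one fun a _ => hf a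
  have h4 : S ∆ T = (S \ T) ∪ (T \ S) := rfl
  rw [h4, Finset.prod_union (by
    rw [Finset.disjoint_left]; intro a ha hb; simp at ha hb; exact hb.2 ha.1), ← h1, ← h2,
    Finset.inter_comm T S, mul_mul_mul_comm, h3, one_mul]

theorem cocycle_mul_self {N : ℕ} (S T : Finset (Fin N)) : cocycle S T * cocycle S T = 1 := by
  rw [cocycle, ← mul_pow]; norm_num

theorem cocycle_ne_zero {N : ℕ} (S T : Finset (Fin N)) : cocycle S T ≠ 0 :=
  left_ne_zero_of_mul_eq_one (cocycle_mul_self S T)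

theorem cocycle_symmDiff_left {N : ℕ} (S S' T : Finset (Fin N)) :
    cocycle (S ∆ S') T = cocycle S T * cocycle S' T := by
  simp only [cocycle_eq_prod]
  refine prod_symmDiff_of_mul_self (fun a => ?_) S S'
  rw [← Finset.prod_mul_distrib]
  exact Finset.prod_eq_one fun b _ => ordSign_mul_self a b

theorem cocycle_symmDiff_right {N : ℕ} (S T T' : Finset (Fin N)) :
    cocycle S (T ∆ T') = cocycle S T * cocycle S T' := by
  simp only [cocycle_eq_prod, ← Finset.prod_mul_distrib]
  exact Finset.prod_congr rfl fun a _ => prod_symmDiff_of_mul_self (ordSign_mul_self a) T T'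

theorem cocycle_empty_left {N : ℕ} (T : Finset (Fin N)) : cocycle ∅ T = 1 := by
  simp [cocycle]

theorem cocycle_empty_right {N : ℕ} (S : Finset (Fin N)) : cocycle S ∅ = 1 := by
  simp [cocycle]

theorem cocycle_singleton {N : ℕ} (a b : Fin N) : cocycle {a} {b} = ordSign a b := by
  simp [cocycle_eq_prod]

theorem star_cocycle {N : ℕ} (S T : Finset (Fin N)) : star (cocycle S T) = cocycle S T := by
  simp [cocycle]

/-- The set of indices which appear an odd number of times in a list. -/
def parity {N : ℕ} : List (Fin N) → Finset (Fin N)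
  | [] => ∅
  | i :: l => {i} ∆ parity l

/-- The sign of a list of indices, `(-1)` to the number of inversions. -/
noncomputable def listSign {N : ℕ} : List (Fin N) → ℂ
  | [] => 1
  | i :: l => cocycle {i} (parity l) * listSign l

theorem parity_append {N : ℕ} (l l' : List (Fin N)) :
    parity (l ++ l') = parity l ∆ parity l' := by
  induction l with
  | nil => exact (bot_symmDiff _).symm
  | cons i l ih => simp [parity, ih, symmDiff_assoc]

/-- The inversions not internal to one of the two lists are the pairs across them, and their number
modulo 2 depends only on the parities. -/
theorem listSign_append {N : ℕ} (l l' : List (Fin N)) :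
    listSign (l ++ l') = listSign l * listSign l' * cocycle (parity l) (parity l') := by
  induction l with
  | nil => simp [parity, listSign, cocycle_empty_left]
  | cons i l ih =>
    simp only [List.cons_append, listSign, ih, parity_append, parity, cocycle_symmDiff_right,
      cocycle_symmDiff_left]
    ring

theorem listSign_mul_self {N : ℕ} (l : List (Fin N)) : listSign l * listSign l = 1 := by
  induction l with
  | nil => simp [listSign]
  | cons i l ih =>
    simp only [listSign]
    rw [mul_mul_mul_comm, ih, cocycle_mul_self, one_mul]

theorem prod_parity {N : ℕ} {M : Type*} [CommMonoid M] {f : Fin N → M}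
    (hf : ∀ a, f a * f a = 1) (l : List (Fin N)) : ∏ a ∈ parity l, f a = (l.map f).prod := by
  induction l with
  | nil => simp [parity]
  | cons i l ih => rw [parity, prod_symmDiff_of_mul_self hf, ih]; simp

theorem listSign_ofFn {N r : ℕ} (k : Fin r → Fin N) :
    listSign (List.ofFn k) = ∏ i, ∏ j ∈ Finset.Ioi i, ordSign (k i) (k j) := by
  induction r with
  | zero => simp [listSign]
  | succ r ih =>
    have hf : ∀ a b : Fin N, ordSign a b * ordSign a b = 1 := ordSign_mul_self
    rw [List.ofFn_succ, listSign, ih, cocycle_eq_prod, Finset.prod_singleton, prod_parity (hf _),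
      List.map_ofFn, List.prod_ofFn, Fin.prod_univ_succ]
    congr 1
    · rw [Fin.prod_Ioi_zero]; rfl
    · exact Finset.prod_congr rfl fun i _ => by rw [Fin.prod_Ioi_succ]

/-- As `a` is increasing, the inversions of `a ∘ σ` are those of `σ`. This is how signatures, and
hence determinants, arise from the cocycle. -/
theorem listSign_ofFn_comp_perm {N r : ℕ} (a : Fin r ↪o Fin N) (σ : Equiv.Perm (Fin r)) :
    listSign (List.ofFn fun t => a (σ t)) = ((Equiv.Perm.sign σ : ℤ) : ℂ) := by
  rw [listSign_ofFn, Equiv.Perm.sign_eq_prod_prod_Ioi]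
  push_cast
  refine Finset.prod_congr rfl fun i _ => Finset.prod_congr rfl fun j hj => ?_
  have hne : σ i ≠ σ j := fun h => (Finset.mem_Ioi.1 hj).ne (σ.injective h)
  unfold ordSign
  rcases lt_or_gt_of_ne hne with h | h
  · simp [h, h.le]
  · simp [h, not_lt.2 h.le]

theorem parity_ofFn_of_injective {N r : ℕ} {k : Fin r → Fin N} (hk : Function.Injective k) :
    parity (List.ofFn k) = Finset.univ.image k := by
  induction r with
  | zero => simp [parity]
  | succ r ih =>
    have hd : Disjoint {k 0} (Finset.univ.image fun i : Fin r => k i.succ) := by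
      rw [Finset.disjoint_singleton_left, Finset.mem_image]
      rintro ⟨y, -, hy⟩
      exact Fin.succ_ne_zero y (hk hy)
    rw [List.ofFn_succ, parity, ih (k := fun i => k i.succ) (hk.comp (Fin.succ_injective r)),
      hd.symmDiff_eq_sup]
    ext x
    simp [Fin.exists_fin_succ, eq_comm]

/-! ### The twisted group algebra of `ℤ₂^N × ℤ₂^N` -/

/-- The dual of `ℤ₂^N × ℤ₂^N`. -/
abbrev BiIdx (N : ℕ) : Type := Finset (Fin N) × Finset (Fin N)

/-- The group law of `BiIdx N`. -/
def BiIdx.add {N : ℕ} (p q : BiIdx N) : BiIdx N := (p.1 ∆ q.1, p.2 ∆ q.2)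

/-- The product bicharacter on `BiIdx N`. -/
noncomputable def bicocycle {N : ℕ} (p q : BiIdx N) : ℂ := cocycle p.1 q.1 * cocycle p.2 q.2

theorem bicocycle_add_left {N : ℕ} (p p' q : BiIdx N) :
    bicocycle (p.add p') q = bicocycle p q * bicocycle p' q := by
  simp only [bicocycle, BiIdx.add, cocycle_symmDiff_left]; ring

theorem bicocycle_add_right {N : ℕ} (p q q' : BiIdx N) :
    bicocycle p (q.add q') = bicocycle p q * bicocycle p q' := by
  simp only [bicocycle, BiIdx.add, cocycle_symmDiff_right]; ring

theorem star_bicocycle {N : ℕ} (p q : BiIdx N) : star (bicocycle p q) = bicocycle p q := by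
  rw [bicocycle, star_mul', star_cocycle, star_cocycle]

theorem BiIdx.eq_add_comm {N : ℕ} (p q r : BiIdx N) : r = p.add q ↔ q = p.add r := by
  constructor <;> rintro rfl <;> simp [BiIdx.add, symmDiff_symmDiff_cancel_left]

section TwistMat

variable {N : ℕ} {B : Type*} [Ring B] [Algebra ℂ B]

/-- The tensor product of the basis element `p` of the twisted group algebra, in its regular
representation, with an element `x` of an algebra. -/
noncomputable def twistMat (p : BiIdx N) (x : B) : CStarMatrix (BiIdx N) (BiIdx N) B :=
  CStarMatrix.ofMatrix (Matrix.of fun r q => if r = p.add q then bicocycle p q • x else 0)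

theorem twistMat_apply (p r q : BiIdx N) (x : B) :
    twistMat p x r q = if r = p.add q then bicocycle p q • x else 0 := rfl

/-- This is the 2-cocycle identity, which holds here because `bicocycle` is multiplicative in each
variable. -/
theorem twistMat_mul (p p' : BiIdx N) (x y : B) :
    twistMat p x * twistMat p' y = bicocycle p p' • twistMat (p.add p') (x * y) := by
  refine CStarMatrix.ext fun r q => ?_
  rw [CStarMatrix.mul_apply, CStarMatrix.smul_apply]
  simp only [twistMat_apply]
  simp only [mul_ite, mul_zero, Finset.sum_ite_eq', Finset.mem_univ, if_true, ite_mul, zero_mul]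
  have h : p.add (p'.add q) = (p.add p').add q := by simp [BiIdx.add, symmDiff_assoc]
  rw [h]
  split_ifs
  · rw [smul_mul_smul_comm, smul_smul, bicocycle_add_left, bicocycle_add_right]
    congr 1; ring
  · rw [smul_zero]

theorem twistMat_sum {ι : Type*} (s : Finset ι) (p : BiIdx N) (f : ι → B) :
    twistMat p (∑ i ∈ s, f i) = ∑ i ∈ s, twistMat p (f i) := by
  classical
  have h0 : twistMat p (0 : B) = 0 := CStarMatrix.ext fun r q => by simp [twistMat_apply]
  have h1 : ∀ x y : B, twistMat p (x + y) = twistMat p x + twistMat p y := fun x y =>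
    CStarMatrix.ext fun r q => by
      rw [CStarMatrix.add_apply]
      simp only [twistMat_apply]
      split_ifs <;> simp
  induction s using Finset.induction_on with
  | empty => simp [h0]
  | insert a s ha ih => rw [Finset.sum_insert ha, Finset.sum_insert ha, h1, ih]

theorem twistMat_zero (p : BiIdx N) : twistMat p (0 : B) = 0 := by
  simpa using twistMat_sum (∅ : Finset Unit) p fun _ => (0 : B)

theorem twistMat_neg (p : BiIdx N) (x : B) : twistMat p (-x) = -twistMat p x :=
  CStarMatrix.ext fun r q => by
    rw [CStarMatrix.neg_apply]; simp only [twistMat_apply]; split_ifs <;> simp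

theorem twistMat_one : twistMat ((∅, ∅) : BiIdx N) (1 : B) = 1 :=
  CStarMatrix.ext fun r q => by
    have : BiIdx.add (∅, ∅) q = q := Prod.ext (bot_symmDiff _) (bot_symmDiff _)
    rw [CStarMatrix.one_apply, twistMat_apply, this]
    simp [bicocycle, cocycle_empty_left]

/-- The basis element `e_p` is unitary with square `bicocycle p p`, so its adjoint is `bicocycle p p
• e_p`. -/
theorem star_twistMat [StarRing B] [StarModule ℂ B] (p : BiIdx N) (x : B) :
    star (twistMat p x) = bicocycle p p • twistMat p (star x) :=
  CStarMatrix.ext fun r q => by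
    rw [CStarMatrix.star_apply, CStarMatrix.smul_apply, twistMat_apply, twistMat_apply]
    by_cases h : q = p.add r
    · have h' : r = p.add q := (BiIdx.eq_add_comm p r q).1 h
      rw [if_pos h, if_pos h', star_smul, star_bicocycle, smul_smul, h', bicocycle_add_right]
    · rw [if_neg h, if_neg fun h' => h ((BiIdx.eq_add_comm p q r).1 h')]
      simp

/-- The twist of a matrix. -/
noncomputable def twistEntry (x : Matrix (Fin N) (Fin N) B) :
    Matrix (Fin N) (Fin N) (CStarMatrix (BiIdx N) (BiIdx N) B) :=
  Matrix.of fun i j => twistMat ({i}, {j}) (x i j)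

theorem twistEntry_apply (x : Matrix (Fin N) (Fin N) B) (i j : Fin N) :
    twistEntry x i j = twistMat ({i}, {j}) (x i j) := rfl


theorem twistEntry_mul (x : Matrix (Fin N) (Fin N) B) (i j k l : Fin N) :
    twistEntry x i j * twistEntry x k l =
      (ordSign i k * ordSign j l) • twistMat ({i} ∆ {k}, {j} ∆ {l}) (x i j * x k l) := by
  rw [twistEntry_apply, twistEntry_apply, twistMat_mul, bicocycle, cocycle_singleton, cocycle_singleton]
  rfl

theorem twistEntry_mul_swap (x : Matrix (Fin N) (Fin N) B) (i j k l : Fin N) :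
    twistEntry x k l * twistEntry x i j =
      (ordSign k i * ordSign l j) • twistMat ({i} ∆ {k}, {j} ∆ {l}) (x k l * x i j) := by
  rw [twistEntry_mul, symmDiff_comm ({k} : Finset (Fin N)), symmDiff_comm ({l} : Finset (Fin N))]

theorem star_twistEntry [StarRing B] [StarModule ℂ B] {x : Matrix (Fin N) (Fin N) B} {i j : Fin N}
    (h : star (x i j) = x i j) : star (twistEntry x i j) = twistEntry x i j := by
  rw [twistEntry_apply, star_twistMat, h, bicocycle, cocycle_singleton, cocycle_singleton,
    ordSign_self, ordSign_self, one_mul, one_smul]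

/-- The common column index `k` contributes the sign `ordSign k k = 1` and the degree `{k} ∆ {k} =
∅`. All terms thus lie over the same basis element, and the sum can be taken inside. -/
theorem twistEntry_row_orthogonal {x : Matrix (Fin N) (Fin N) B}
    (h : ∀ i j, ∑ k, x i k * x j k = if i = j then 1 else 0) (i j : Fin N) :
    ∑ k, twistEntry x i k * twistEntry x j k = if i = j then 1 else 0 := by
  simp only [twistEntry_mul, ordSign_self, mul_one, symmDiff_self]
  rw [← Finset.smul_sum, ← twistMat_sum, h]
  split_ifs with hij
  · subst hij
    rw [ordSign_self, one_smul, symmDiff_self]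
    exact twistMat_one
  · rw [twistMat_zero, smul_zero]

theorem twistEntry_col_orthogonal {x : Matrix (Fin N) (Fin N) B}
    (h : ∀ i j, ∑ k, x k i * x k j = if i = j then 1 else 0) (i j : Fin N) :
    ∑ k, twistEntry x k i * twistEntry x k j = if i = j then 1 else 0 := by
  simp only [twistEntry_mul, ordSign_self, one_mul, symmDiff_self]
  rw [← Finset.smul_sum, ← twistMat_sum, h]
  split_ifs with hij
  · subst hij
    rw [ordSign_self, one_smul, symmDiff_self]
    exact twistMat_one
  · rw [twistMat_zero, smul_zero]

/-- The twist of a twisted orthogonal matrix has commuting entries. -/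
theorem IsTwistedOrthogonal.twistEntry_commute [StarRing B] {x : Matrix (Fin N) (Fin N) B}
    (h : IsTwistedOrthogonal x) (i j k l : Fin N) :
    twistEntry x i j * twistEntry x k l = twistEntry x k l * twistEntry x i j := by
  rw [twistEntry_mul, twistEntry_mul_swap]
  -- Each pair of distinct indices gives one sign under exchange: in a common row or column it
  -- compensates the anticommutation, and otherwise the two signs cancel.
  by_cases hik : i = k
  · subst hik
    by_cases hjl : j = l
    · subst hjl; rfl
    · rw [h.row_anticomm i j l hjl, twistMat_neg, ordSign_swap hjl]
      simp
  · by_cases hjl : j = l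
    · subst hjl
      rw [h.col_anticomm i k j hik, twistMat_neg, ordSign_swap hik]
      simp
    · rw [h.comm i k j l hik hjl, ordSign_swap hik, ordSign_swap hjl, neg_mul_neg]

/-- The twist of an orthogonal matrix with commuting entries is twisted orthogonal. -/
theorem isTwistedOrthogonal_twistEntry {B : Type*} [CommRing B] [StarRing B] [Algebra ℂ B]
    [StarModule ℂ B] {x : Matrix (Fin N) (Fin N) B} (hs : ∀ i j, star (x i j) = x i j)
    (hr : ∀ i j, ∑ k, x i k * x j k = if i = j then 1 else 0)
    (hc : ∀ i j, ∑ k, x k i * x k j = if i = j then 1 else 0) :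
    IsTwistedOrthogonal (twistEntry x) where
  selfAdjoint i j := star_twistEntry (hs i j)
  row_orthogonal := twistEntry_row_orthogonal hr
  col_orthogonal := twistEntry_col_orthogonal hc
  row_anticomm i j l h := by
    rw [twistEntry_mul, twistEntry_mul_swap, ordSign_swap h, mul_comm (x i l)]
    simp
  col_anticomm i k j h := by
    rw [twistEntry_mul, twistEntry_mul_swap, ordSign_swap h, mul_comm (x k j)]
    simp
  comm i k j l h h' := by
    rw [twistEntry_mul, twistEntry_mul_swap, ordSign_swap h, ordSign_swap h', mul_comm (x k l),
      neg_mul_neg]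

/-- Words in the coordinates of a matrix. -/
def wordProd {N : ℕ} {B : Type*} [Monoid B] (x : Matrix (Fin N) (Fin N) B) (l : List (Fin N × Fin N)) :
    B :=
  (l.map fun p => x p.1 p.2).prod

/-- The sign of a word. -/
noncomputable def wordSign {N : ℕ} (l : List (Fin N × Fin N)) : ℂ :=
  listSign (l.map Prod.fst) * listSign (l.map Prod.snd)

/-- The bidegree of a word. -/
def bideg {N : ℕ} (l : List (Fin N × Fin N)) : BiIdx N :=
  (parity (l.map Prod.fst), parity (l.map Prod.snd))

theorem wordSign_mul_self (l : List (Fin N × Fin N)) : wordSign l * wordSign l = 1 := by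
  rw [wordSign, mul_mul_mul_comm, listSign_mul_self, listSign_mul_self, one_mul]

theorem wordSign_append (l l' : List (Fin N × Fin N)) :
    wordSign (l ++ l') = wordSign l * wordSign l' * bicocycle (bideg l) (bideg l') := by
  simp only [wordSign, List.map_append, listSign_append, bicocycle, bideg]
  ring

theorem wordProd_append {B : Type*} [Monoid B] (x : Matrix (Fin N) (Fin N) B)
    (l l' : List (Fin N × Fin N)) : wordProd x (l ++ l') = wordProd x l * wordProd x l' := by
  simp [wordProd]

theorem map_wordProd {B C F : Type*} [Monoid B] [Monoid C] [FunLike F B C] [MonoidHomClass F B C]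
    (f : F) (x : Matrix (Fin N) (Fin N) B) (l : List (Fin N × Fin N)) :
    f (wordProd x l) = wordProd (x.map f) l := by
  rw [wordProd, map_list_prod, List.map_map]
  rfl

/-- Multiplying by one more letter gives `bicocycle` of that letter with the rest of the word, which
counts the new inversions among the row indices and among the column indices. -/
theorem wordProd_twistEntry (x : Matrix (Fin N) (Fin N) B) (l : List (Fin N × Fin N)) :
    wordProd (twistEntry x) l = wordSign l • twistMat (bideg l) (wordProd x l) := by
  induction l with
  | nil => simpa [wordProd, wordSign, bideg, listSign, parity] using twistMat_one.symm
  | cons p l ih =>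
    have h : wordProd (twistEntry x) (p :: l) = twistEntry x p.1 p.2 * wordProd (twistEntry x) l :=
      List.prod_cons
    have h' : wordProd x (p :: l) = x p.1 p.2 * wordProd x l := List.prod_cons
    rw [h, ih, mul_smul_comm, twistEntry_apply, twistMat_mul, smul_smul, h']
    congr 1
    simp only [wordSign, bideg, bicocycle, listSign, List.map_cons]
    ring

/-- The sum of the entries of the column `(∅, ∅)`. -/
noncomputable def colSum (N : ℕ) (B : Type*) [Ring B] [Algebra ℂ B] :
    CStarMatrix (BiIdx N) (BiIdx N) B →ₗ[ℂ] B where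
  toFun M := ∑ r, M r (∅, ∅)
  map_add' M M' := by simp [Finset.sum_add_distrib]
  map_smul' c M := by simp [Finset.smul_sum]

/-- In the column `(∅, ∅)` the only possible nonzero entry sits in row `p`, with sign `cocycle _ ∅ =
1`. So `colSum` forgets the group algebra factor, for all degrees `p` at once. -/
theorem colSum_twistMat (p : BiIdx N) (x : B) : colSum N B (twistMat p x) = x := by
  change ∑ r, twistMat p x r (∅, ∅) = x
  simp [twistMat_apply, bicocycle, cocycle_empty_right]

theorem colSum_wordProd_twistEntry (x : Matrix (Fin N) (Fin N) B) (l : List (Fin N × Fin N)) :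
    colSum N B (wordProd (twistEntry x) l) = wordSign l • wordProd x l := by
  rw [wordProd_twistEntry, map_smul, colSum_twistMat]

end TwistMat

/-! ### Comparison of the linear relations between words -/

/-- Evaluation at a point of `O_N`, as a morphism of algebras. -/
noncomputable def evalHom {N : ℕ} (g : O N) : PolO N →ₐ[ℂ] ℂ :=
  (ContinuousMap.evalAlgHom ℂ ℂ g).comp (polO N).val

theorem evalHom_apply {N : ℕ} (g : O N) (x : PolO N) : evalHom g x = evalO x g := rfl

theorem evalHom_uO {N : ℕ} (g : O N) (i j : Fin N) :
    evalHom g (uO N i j) = ((g : Matrix (Fin N) (Fin N) ℝ) i j : ℂ) := rfl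

theorem PolO.ext {N : ℕ} {x y : PolO N} (h : ∀ g, evalHom g x = evalHom g y) : x = y :=
  Subtype.ext (ContinuousMap.ext h)

theorem orthogonal_rows {N : ℕ} (g : O N) (i j : Fin N) :
    ∑ k, ((g : Matrix (Fin N) (Fin N) ℝ) i k : ℂ) * ((g : Matrix (Fin N) (Fin N) ℝ) j k : ℂ) =
      if i = j then 1 else 0 := by
  have h := congrFun (congrFun ((Matrix.mem_orthogonalGroup_iff _ _).1 g.2) i) j
  rw [Matrix.mul_apply, Matrix.one_apply] at h
  have h' := congrArg Complex.ofReal h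
  push_cast [apply_ite Complex.ofReal] at h'
  exact h'

theorem orthogonal_cols {N : ℕ} (g : O N) (i j : Fin N) :
    ∑ k, ((g : Matrix (Fin N) (Fin N) ℝ) k i : ℂ) * ((g : Matrix (Fin N) (Fin N) ℝ) k j : ℂ) =
      if i = j then 1 else 0 := by
  have h := congrFun (congrFun ((Matrix.mem_orthogonalGroup_iff' _ _).1 g.2) i) j
  rw [Matrix.mul_apply, Matrix.one_apply] at h
  have h' := congrArg Complex.ofReal h
  push_cast [apply_ite Complex.ofReal] at h'
  exact h'

/-- Commuting self-adjoint elements of a C*-algebra which form an orthogonal matrix satisfy all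
the linear relations between words in the coordinates of `O_N`. -/
theorem linearCombination_eq_zero_of_commute {N : ℕ} {B : Type*} [CStarAlgebra B]
    {x : Matrix (Fin N) (Fin N) B} (hs : ∀ i j, star (x i j) = x i j)
    (hr : ∀ i j, ∑ k, x i k * x j k = if i = j then 1 else 0)
    (hc : ∀ i j k l, x i j * x k l = x k l * x i j) {p : List (Fin N × Fin N) →₀ ℂ}
    (hp : Finsupp.linearCombination ℂ (wordProd (uO N)) p = 0) :
    Finsupp.linearCombination ℂ (wordProd x) p = 0 := by
  set R : Set B := Set.range fun q : Fin N × Fin N => x q.1 q.2 with hR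
  set C : StarSubalgebra ℂ B := (StarAlgebra.adjoin ℂ R).topologicalClosure with hC
  have hcl : IsClosed (C : Set B) := StarSubalgebra.isClosed_topologicalClosure _
  -- Commutativity of the generators passes to the *-algebra they generate, as they are
  -- self-adjoint, and then to its closure.
  have hcomm : ∀ a b : C, a * b = b * a := by
    have := StarAlgebra.isMulCommutative_adjoin ℂ (s := R)
      (by rintro _ ⟨a, rfl⟩ _ ⟨b, rfl⟩; exact hc _ _ _ _)
      (by rintro _ ⟨a, rfl⟩ _ ⟨b, rfl⟩; rw [hs]; exact hc _ _ _ _)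
    let := StarSubalgebra.commRingTopologicalClosure (StarAlgebra.adjoin ℂ R) fun a b => mul_comm' a b
    intro a b
    exact mul_comm (G := (StarAlgebra.adjoin ℂ R).topologicalClosure) a b
  let : CommCStarAlgebra C := { (inferInstance : CStarAlgebra C) with mul_comm := hcomm }
  let y : Matrix (Fin N) (Fin N) C := Matrix.of fun i j => ⟨x i j, StarSubalgebra.le_topologicalClosure _
    (StarAlgebra.subset_adjoin ℂ _ ⟨(i, j), rfl⟩)⟩
  have hz : Finsupp.linearCombination ℂ (wordProd y) p = 0 := by
    -- It suffices to apply each character `φ` of the commutative C*-algebra `C`. The numbers `φ (y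
    -- i j)` are real by self-adjointness and form an orthogonal matrix `g`, at which the assumed
    -- relation between functions on `O_N` can be evaluated.
    refine (gelfandTransform_isometry C).injective ?_
    rw [map_zero]
    ext φ
    rw [WeakDual.gelfandTransform_apply_apply, ContinuousMap.zero_apply]
    have hre : ∀ i j, ((φ (y i j)).re : ℂ) = φ (y i j) := by
      intro i j
      have h1 : star (y i j) = y i j := Subtype.ext (hs i j)
      have h2 : φ (star (y i j)) = star (φ (y i j)) := map_star φ (y i j)
      rw [h1] at h2
      exact Complex.conj_eq_iff_re.1 h2.symm
    have hyr : ∀ i j, ∑ k, y i k * y j k = if i = j then 1 else 0 := by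
      intro i j
      apply Subtype.ext
      rw [AddSubmonoidClass.coe_finsetSum]
      refine (hr i j).trans ?_
      split_ifs <;> rfl
    let g : O N := ⟨Matrix.of fun i j => (φ (y i j)).re, by
      rw [Matrix.mem_orthogonalGroup_iff]
      ext i j
      rw [Matrix.mul_apply, Matrix.one_apply]
      have h := congrArg φ (hyr i j)
      rw [map_sum] at h
      simp only [map_mul] at h
      apply Complex.ofReal_injective
      simp only [Matrix.transpose_apply, Matrix.of_apply, Complex.ofReal_sum,
        Complex.ofReal_mul, hre]
      rw [h]
      split_ifs
      · rw [map_one, Complex.ofReal_one]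
      · rw [map_zero, Complex.ofReal_zero]⟩
    have h1 := congrArg (evalHom g) hp
    rw [map_zero, Finsupp.linearCombination_apply, Finsupp.sum, map_sum] at h1
    rw [Finsupp.linearCombination_apply, Finsupp.sum, map_sum, ← h1]
    refine Finset.sum_congr rfl fun l _ => ?_
    rw [map_smul, map_smul, map_wordProd, map_wordProd]
    congr 2
    ext i j
    exact (hre i j).symm
  have h := congrArg C.subtype hz
  rw [map_zero, Finsupp.linearCombination_apply, Finsupp.sum, map_sum] at h
  rw [Finsupp.linearCombination_apply, Finsupp.sum, ← h]
  refine Finset.sum_congr rfl fun l _ => ?_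
  rw [map_smul, map_wordProd]
  rfl

theorem linearCombination_twist {N : ℕ} {B : Type*} [CStarAlgebra B] (x : Matrix (Fin N) (Fin N) B)
    (p : List (Fin N × Fin N) →₀ ℂ) :
    colSum N B (Finsupp.linearCombination ℂ (wordProd (twistEntry x)) p) =
      Finsupp.linearCombination ℂ (fun l => wordSign l • wordProd x l) p := by
  simp only [Finsupp.linearCombination_apply, Finsupp.sum, map_sum, map_smul,
    colSum_wordProd_twistEntry]

/-- The words in the standard coordinates of `Ō_N`, with their signs, satisfy all the linear
relations between the words in the coordinates of `O_N`. -/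
theorem linearCombination_ubar_eq_zero {N : ℕ} {p : List (Fin N × Fin N) →₀ ℂ}
    (hp : Finsupp.linearCombination ℂ (wordProd (uO N)) p = 0) :
    Finsupp.linearCombination ℂ (fun l => wordSign l • wordProd (ubar N) l) p = 0 := by
  -- The order is used by the C*-algebra structure on matrices over `CObar N`.
  let : PartialOrder (CObar N) := CStarAlgebra.spectralOrder _
  let : StarOrderedRing (CObar N) := CStarAlgebra.spectralOrderedRing _
  have hu := isTwistedOrthogonal_cCoord N
  -- The twist of the universal solution is a commuting orthogonal matrix, so it satisfies the
  -- relation `p`; `colSum` then brings this back to signed words in the coordinates.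
  have h := linearCombination_eq_zero_of_commute
    (x := twistEntry (Matrix.of (cCoord N))) (fun i j => star_twistEntry (hu.selfAdjoint i j))
    (twistEntry_row_orthogonal hu.row_orthogonal) hu.twistEntry_commute hp
  have h' := linearCombination_twist (Matrix.of (cCoord N)) p
  rw [h, map_zero] at h'
  apply Subtype.ext
  refine Eq.trans ?_ h'.symm
  change (polObar N).subtype _ = _
  simp only [Finsupp.linearCombination_apply, Finsupp.sum, map_sum, map_smul]
  refine Finset.sum_congr rfl fun l _ => ?_
  rw [map_wordProd]
  rfl

open scoped ComplexOrder in
/-- The solution of the relations of `Ō_N` given by a point of `O_N`. -/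
noncomputable def pointSolution {N : ℕ} (g : O N) : Solution N where
  carrier := CStarMatrix (BiIdx N) (BiIdx N) ℂ
  entry := twistEntry ((g : Matrix (Fin N) (Fin N) ℝ).map Complex.ofReal)
  rel := isTwistedOrthogonal_twistEntry (fun _ _ => Complex.conj_ofReal _) (orthogonal_rows g)
    (orthogonal_cols g)

/-- The universal property of `Ō_N`, applied to the twist of `g`, gives a morphism `f` on `PolObar
N`. The sign from `colSum` cancels the sign of the word, leaving the word in the entries of `g`. -/
theorem linearCombination_uO_eq_zero {N : ℕ} {p : List (Fin N × Fin N) →₀ ℂ}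
    (hp : Finsupp.linearCombination ℂ (fun l => wordSign l • wordProd (ubar N) l) p = 0) :
    Finsupp.linearCombination ℂ (wordProd (uO N)) p = 0 := by
  apply PolO.ext
  intro g
  let f : PolObar N →⋆ₐ[ℂ] CStarMatrix (BiIdx N) (BiIdx N) ℂ :=
    (toSolution (pointSolution g)).comp (polObar N).subtype
  have h := congrArg (fun x => colSum N ℂ (f x)) hp
  simp only [map_zero, Finsupp.linearCombination_apply, Finsupp.sum, map_sum, map_smul] at h ⊢
  rw [← h]
  refine Finset.sum_congr rfl fun l _ => ?_
  have h2 := colSum_wordProd_twistEntry ((g : Matrix (Fin N) (Fin N) ℝ).map Complex.ofReal) l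
  have h3 : f (wordProd (ubar N) l) =
      wordProd (twistEntry ((g : Matrix (Fin N) (Fin N) ℝ).map Complex.ofReal)) l :=
    map_wordProd f _ _
  rw [h3, h2, smul_smul (wordSign l), wordSign_mul_self, one_smul, map_wordProd]
  rfl

/-! ### The twisting map -/

theorem wordProd_nil {N : ℕ} {B : Type*} [Monoid B] (x : Matrix (Fin N) (Fin N) B) :
    wordProd x [] = 1 := rfl

theorem wordProd_singleton {N : ℕ} {B : Type*} [Monoid B] (x : Matrix (Fin N) (Fin N) B)
    (i j : Fin N) : wordProd x [(i, j)] = x i j := List.prod_singleton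

theorem mul_mem_span_wordProd {N : ℕ} {B : Type*} [Ring B] [Algebra ℂ B]
    {x : Matrix (Fin N) (Fin N) B} {a b : B} (ha : a ∈ Submodule.span ℂ (Set.range (wordProd x)))
    (hb : b ∈ Submodule.span ℂ (Set.range (wordProd x))) :
    a * b ∈ Submodule.span ℂ (Set.range (wordProd x)) := by
  have h := Submodule.mul_mem_mul ha hb
  rw [Submodule.span_mul_span] at h
  refine Submodule.span_mono ?_ h
  rintro _ ⟨_, ⟨l, rfl⟩, _, ⟨l', rfl⟩, rfl⟩
  exact ⟨l ++ l', wordProd_append x l l'⟩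

theorem algebraMap_mem_span_wordProd {N : ℕ} {B : Type*} [Ring B] [Algebra ℂ B]
    (x : Matrix (Fin N) (Fin N) B) (c : ℂ) :
    algebraMap ℂ B c ∈ Submodule.span ℂ (Set.range (wordProd x)) := by
  rw [Algebra.algebraMap_eq_smul_one]
  exact Submodule.smul_mem _ _ (Submodule.subset_span ⟨[], rfl⟩)

theorem span_wordProd_uO (N : ℕ) : Submodule.span ℂ (Set.range (wordProd (uO N))) = ⊤ := by
  rw [eq_top_iff]
  rintro ⟨x, hx⟩ -
  induction hx using Algebra.adjoin_induction with
  | mem x h =>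
    obtain ⟨p, rfl⟩ := h
    exact Submodule.subset_span ⟨[p], wordProd_singleton _ _ _⟩
  | algebraMap c => exact algebraMap_mem_span_wordProd (uO N) c
  | add x y hx hy h h' => exact Submodule.add_mem _ h h'
  | mul x y hx hy h h' => exact mul_mem_span_wordProd (a := (⟨x, hx⟩ : PolO N)) (b := ⟨y, hy⟩) h h'

theorem star_wordProd {N : ℕ} {B : Type*} [Ring B] [StarRing B]
    {x : Matrix (Fin N) (Fin N) B} (h : ∀ i j, star (x i j) = x i j)
    (l : List (Fin N × Fin N)) : star (wordProd x l) = wordProd x l.reverse := by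
  induction l with
  | nil => exact star_one _
  | cons p l ih =>
    have h1 : wordProd x (p :: l) = x p.1 p.2 * wordProd x l := List.prod_cons
    rw [h1, star_mul, ih, h, List.reverse_cons, wordProd_append, wordProd_singleton]

theorem star_mem_span_wordProd {N : ℕ} {B : Type*} [Ring B] [StarRing B] [Algebra ℂ B]
    [StarModule ℂ B] {x : Matrix (Fin N) (Fin N) B} (hx : ∀ i j, star (x i j) = x i j) {a : B}
    (ha : a ∈ Submodule.span ℂ (Set.range (wordProd x))) :
    star a ∈ Submodule.span ℂ (Set.range (wordProd x)) := by
  induction ha using Submodule.span_induction with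
  | mem a h =>
    obtain ⟨l, rfl⟩ := h
    exact Submodule.subset_span ⟨l.reverse, (star_wordProd hx l).symm⟩
  | zero => rw [star_zero]; exact Submodule.zero_mem _
  | add a b _ _ ha hb => rw [star_add]; exact Submodule.add_mem _ ha hb
  | smul c a _ ha => rw [star_smul]; exact Submodule.smul_mem _ _ ha

theorem span_wordProd_ubar (N : ℕ) : Submodule.span ℂ (Set.range (wordProd (ubar N))) = ⊤ := by
  rw [eq_top_iff]
  rintro x -
  induction x using StarAlgebra.adjoin_induction_subtype with
  | mem x h =>
    obtain ⟨p, rfl⟩ := h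
    exact Submodule.subset_span ⟨[p], wordProd_singleton _ _ _⟩
  | algebraMap c => exact algebraMap_mem_span_wordProd (ubar N) c
  | add x y h h' => exact Submodule.add_mem _ h h'
  | mul x y h h' => exact mul_mem_span_wordProd h h'
  | star x h =>
    exact star_mem_span_wordProd (B := PolObar N) (isTwistedOrthogonal_ubar N).selfAdjoint h

theorem linearCombination_uO_surjective (N : ℕ) :
    Function.Surjective (Finsupp.linearCombination ℂ (wordProd (uO N))) := by
  rw [← LinearMap.range_eq_top, Finsupp.range_linearCombination, span_wordProd_uO]

theorem linearCombination_ubar_surjective (N : ℕ) : Function.Surjective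
    (Finsupp.linearCombination ℂ fun l => wordSign l • wordProd (ubar N) l) := by
  rw [← LinearMap.range_eq_top, Finsupp.range_linearCombination, eq_top_iff, ← span_wordProd_ubar,
    Submodule.span_le]
  rintro _ ⟨l, rfl⟩
  have h : wordProd (ubar N) l = wordSign l • wordSign l • wordProd (ubar N) l := by
    rw [smul_smul, wordSign_mul_self, one_smul]
  rw [h]
  exact Submodule.smul_mem _ _ (Submodule.subset_span ⟨l, rfl⟩)

/-- The target is only an additive monoid, so the difference is formed in the source and negation is
replaced by the scalar `-1`. -/
theorem map_eq_iff_sub {W V : Type*} [AddCommGroup W] [AddCommMonoid V] [Module ℂ W] [Module ℂ V]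
    (f : W →ₗ[ℂ] V) (a b : W) : f a = f b ↔ f (a - b) = 0 := by
  constructor <;> intro h
  · rw [sub_eq_add_neg, ← neg_one_smul ℂ b, map_add, map_smul, h]
    nth_rewrite 1 [← one_smul ℂ (f b)]
    rw [← add_smul, add_neg_cancel, zero_smul]
  · rw [← sub_add_cancel a b, map_add, h, zero_add]

theorem exists_linearEquiv_of_eq_iff {W V V' : Type*} [AddCommMonoid W] [AddCommMonoid V]
    [AddCommMonoid V'] [Module ℂ W] [Module ℂ V] [Module ℂ V'] {f : W →ₗ[ℂ] V} {f' : W →ₗ[ℂ] V'}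
    (hf : Function.Surjective f) (hf' : Function.Surjective f')
    (h : ∀ a b, f a = f b ↔ f' a = f' b) : ∃ e : V ≃ₗ[ℂ] V', ∀ w, e (f w) = f' w := by
  have h1 : ∀ w, f' (Function.surjInv hf (f w)) = f' w := fun w =>
    (h _ _).1 (Function.surjInv_eq hf _)
  have h2 : ∀ w, f (Function.surjInv hf' (f' w)) = f w := fun w =>
    (h _ _).2 (Function.surjInv_eq hf' _)
  refine ⟨{ toFun := fun v => f' (Function.surjInv hf v)
            invFun := fun v => f (Function.surjInv hf' v)
            map_add' := fun v v' => ?_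
            map_smul' := fun c v => ?_
            left_inv := fun v => ?_
            right_inv := fun v => ?_ }, h1⟩
  · obtain ⟨w, rfl⟩ := hf v
    obtain ⟨w', rfl⟩ := hf v'
    rw [← map_add, h1, h1, h1, map_add]
  · obtain ⟨w, rfl⟩ := hf v
    rw [← map_smul, h1, h1, map_smul, RingHom.id_apply]
  · obtain ⟨w, rfl⟩ := hf v
    change f (Function.surjInv hf' (f' (Function.surjInv hf (f w)))) = f w
    rw [h1, h2]
  · obtain ⟨w, rfl⟩ := hf' v
    change f' (Function.surjInv hf (f (Function.surjInv hf' (f' w)))) = f' w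
    rw [h2, h1]

/-- Both algebras are quotients of the free vector space on words, by the same subspace of
relations. -/
theorem exists_theta (N : ℕ) : ∃ θ : PolO N ≃ₗ[ℂ] PolObar N,
    ∀ l, θ (wordProd (uO N) l) = wordSign l • wordProd (ubar N) l := by
  obtain ⟨θ, h⟩ := exists_linearEquiv_of_eq_iff (linearCombination_uO_surjective N)
    (linearCombination_ubar_surjective N) fun a b => by
      rw [map_eq_iff_sub, map_eq_iff_sub]
      exact ⟨linearCombination_ubar_eq_zero, linearCombination_uO_eq_zero⟩
  refine ⟨θ, fun l => ?_⟩
  have hl := h (Finsupp.single l 1)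
  rwa [Finsupp.linearCombination_single, Finsupp.linearCombination_single, one_smul,
    one_smul] at hl

/-- The twisting map, which sends the words in the coordinates of `O_N` to the corresponding words
in the coordinates of `Ō_N`, up to a sign. -/
noncomputable def theta (N : ℕ) : PolO N ≃ₗ[ℂ] PolObar N := (exists_theta N).choose

theorem theta_wordProd {N : ℕ} (l : List (Fin N × Fin N)) :
    theta N (wordProd (uO N) l) = wordSign l • wordProd (ubar N) l :=
  (exists_theta N).choose_spec l

/-- The character of the group of diagonal sign matrices given by a set of indices. -/
noncomputable def signChar {N : ℕ} (S : Finset (Fin N)) (d : Fin N → ℤˣ) : ℂ :=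
  ∏ i ∈ S, (((d i : ℤ)) : ℂ)

theorem unit_mul_self (e : ℤˣ) : ((e : ℤ) : ℂ) * ((e : ℤ) : ℂ) = 1 := by
  rcases Int.units_eq_one_or e with h | h <;> simp [h]

theorem signChar_symmDiff {N : ℕ} (S T : Finset (Fin N)) (d : Fin N → ℤˣ) :
    signChar (S ∆ T) d = signChar S d * signChar T d :=
  prod_symmDiff_of_mul_self (fun i => unit_mul_self (d i)) S T

theorem signChar_mul_self {N : ℕ} (S : Finset (Fin N)) (d : Fin N → ℤˣ) :
    signChar S d * signChar S d = 1 := by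
  rw [← signChar_symmDiff, symmDiff_self]
  rfl

theorem signChar_mul {N : ℕ} (S : Finset (Fin N)) (d e : Fin N → ℤˣ) :
    signChar S (d * e) = signChar S d * signChar S e := by
  simp [signChar, Finset.prod_mul_distrib]

theorem sum_signChar {N : ℕ} (S : Finset (Fin N)) :
    ∑ d, signChar S d = if S = ∅ then (2 : ℂ) ^ N else 0 := by
  have h : ∀ d : Fin N → ℤˣ, signChar S d = ∏ i, if i ∈ S then ((d i : ℤ) : ℂ) else 1 := by
    intro d
    simp [signChar]
  simp only [h]
  rw [← Fintype.prod_sum (fun (i : Fin N) (e : ℤˣ) => if i ∈ S then ((e : ℤ) : ℂ) else 1)]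
  have h2 : ∀ i : Fin N, ∑ e : ℤˣ, (if i ∈ S then ((e : ℤ) : ℂ) else 1) =
      if i ∈ S then 0 else 2 := by
    intro i
    rw [show (Finset.univ : Finset ℤˣ) = {1, -1} from rfl,
      Finset.sum_pair (by decide)]
    split_ifs <;> norm_num
  simp only [h2]
  split_ifs with hS
  · simp [hS]
  · obtain ⟨i, hi⟩ := Finset.nonempty_iff_ne_empty.2 hS
    exact Finset.prod_eq_zero (Finset.mem_univ i) (if_pos hi)

theorem sum_signChar_mul {N : ℕ} (S T : Finset (Fin N)) :
    ∑ d, signChar S d * signChar T d = if S = T then (2 : ℂ) ^ N else 0 := by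
  simp only [← signChar_symmDiff, sum_signChar]
  congr 1
  exact propext symmDiff_eq_bot

/-- A letter `u_{ij}` is multiplied by `d_i e_j`; indices occurring an even number of times
disappear, which is the meaning of `parity`. -/
theorem hasBidegree_wordProd {N : ℕ} (l : List (Fin N × Fin N)) :
    HasBidegree (bideg l).1 (bideg l).2 (wordProd (uO N) l) := by
  intro d e g
  rw [← evalHom_apply, ← evalHom_apply, map_wordProd, map_wordProd]
  induction l with
  | nil => simp [wordProd, bideg, parity]
  | cons p l ih =>
    have h1 : ∀ x : Matrix (Fin N) (Fin N) ℂ, wordProd x (p :: l) = x p.1 p.2 * wordProd x l :=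
      fun x => List.prod_cons
    have h2 : (((signDiag d * g * signDiag e : O N) : Matrix (Fin N) (Fin N) ℝ) p.1 p.2 : ℝ) =
        ((d p.1 : ℤ) : ℝ) * (g : Matrix (Fin N) (Fin N) ℝ) p.1 p.2 * ((e p.2 : ℤ) : ℝ) := by
      change ((Matrix.diagonal fun i => ((d i : ℤ) : ℝ)) * (g : Matrix (Fin N) (Fin N) ℝ) *
        Matrix.diagonal fun i => ((e i : ℤ) : ℝ) : Matrix (Fin N) (Fin N) ℝ) p.1 p.2 = _
      rw [Matrix.mul_diagonal, Matrix.diagonal_mul]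
    have h3 : ∀ (f : Fin N → ℤˣ) (i : Fin N) (S : Finset (Fin N)),
        ∏ j ∈ {i} ∆ S, (((f j : ℤ)) : ℂ) = ((f i : ℤ) : ℂ) * ∏ j ∈ S, (((f j : ℤ)) : ℂ) := by
      intro f i S
      rw [prod_symmDiff_of_mul_self (fun i => unit_mul_self (f i)), Finset.prod_singleton]
    rw [h1, h1, ih]
    simp only [bideg, List.map_cons, parity, h3, Matrix.map_apply, evalHom_uO, h2]
    push_cast
    ring

/-- A bihomogeneous element is a linear combination of words of the same bidegree. -/
theorem HasBidegree.mem_span {N : ℕ} {S T : Finset (Fin N)} {x : PolO N} (hx : HasBidegree S T x) :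
    x ∈ Submodule.span ℂ (wordProd (uO N) '' {l | bideg l = (S, T)}) := by
  obtain ⟨p, hp⟩ := linearCombination_uO_surjective N x
  rw [Finsupp.linearCombination_apply, Finsupp.sum] at hp
  -- Averaging over `d` and `e` against `signChar S d * signChar T e` fixes `x` by hypothesis, and
  -- kills the words of other bidegrees by orthogonality of characters. The factor `2^N * 2^N` is
  -- the number of pairs `(d, e)`.
  have key : x = ∑ l ∈ p.support, if bideg l = (S, T) then p l • wordProd (uO N) l else 0 := by
    apply PolO.ext
    intro g
    have hne : ((2 : ℂ) ^ N * (2 : ℂ) ^ N) ≠ 0 :=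
      mul_ne_zero (pow_ne_zero _ two_ne_zero) (pow_ne_zero _ two_ne_zero)
    apply mul_left_cancel₀ hne
    have h1 : ((2 : ℂ) ^ N * (2 : ℂ) ^ N) * evalHom g x = ∑ d, ∑ e, signChar S d * signChar T e *
        evalHom (signDiag d * g * signDiag e) x := by
      have h0 : ∀ d e, signChar S d * signChar T e * evalHom (signDiag d * g * signDiag e) x =
          evalHom g x := by
        intro d e
        have h := hx d e g
        rw [← evalHom_apply, ← evalHom_apply] at h
        change _ = signChar S d * signChar T e * evalHom g x at h
        rw [h]
        linear_combination (signChar T e * signChar T e * evalHom g x) * signChar_mul_self S d +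
          evalHom g x * signChar_mul_self T e
      simp only [h0]
      simp [mul_assoc]
    rw [h1, ← hp]
    simp only [map_sum, Finset.mul_sum]
    rw [Finset.sum_congr rfl fun d _ => Finset.sum_comm, Finset.sum_comm]
    refine Finset.sum_congr rfl fun l _ => ?_
    have h2 : ∀ d e, signChar S d * signChar T e *
        evalHom (signDiag d * g * signDiag e) (p l • wordProd (uO N) l) =
        (signChar S d * signChar (bideg l).1 d) * (signChar T e * signChar (bideg l).2 e) *
        evalHom g (p l • wordProd (uO N) l) := by
      intro d e
      have h := hasBidegree_wordProd l d e g
      rw [← evalHom_apply, ← evalHom_apply] at h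
      change _ = signChar _ d * signChar _ e * _ at h
      rw [map_smul, map_smul, h, smul_eq_mul, smul_eq_mul]
      ring
    simp only [h2]
    simp only [← Finset.sum_mul, ← Finset.mul_sum]
    rw [sum_signChar_mul, sum_signChar_mul]
    by_cases hl : bideg l = (S, T)
    · simp [hl]
    · rw [if_neg hl, map_zero]
      by_cases hS : S = (bideg l).1
      · rw [if_neg fun hT : T = (bideg l).2 => hl (by rw [hS, hT])]
        simp
      · simp [hS]
  rw [key]
  refine Submodule.sum_mem _ fun l _ => ?_
  split_ifs with h
  · exact Submodule.smul_mem _ _ (Submodule.subset_span ⟨l, h, rfl⟩)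
  · exact Submodule.zero_mem _

/-- By `HasBidegree.mem_span` and bilinearity, the product rule reduces to words of fixed bidegrees,
where it is `wordSign_append`. -/
theorem isTwist_theta (N : ℕ) : IsTwist (theta N) where
  map_one := by
    have h := theta_wordProd (N := N) []
    rw [wordProd_nil, wordProd_nil] at h
    simpa [wordSign, listSign] using h
  map_coord i j := by
    have h := theta_wordProd [(i, j)]
    rw [wordProd_singleton, wordProd_singleton] at h
    simpa [wordSign, listSign, parity, cocycle_empty_right] using h
  map_mul S T S' T' x y hx hy := by
    have key : ∀ x ∈ Submodule.span ℂ (wordProd (uO N) '' {l | bideg l = (S, T)}),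
        ∀ y ∈ Submodule.span ℂ (wordProd (uO N) '' {l | bideg l = (S', T')}),
        theta N x * theta N y = (cocycle S S' * cocycle T T') • theta N (x * y) := by
      intro x hx y hy
      induction hx, hy using Submodule.span_induction₂ with
      | mem_mem x y hx hy =>
        obtain ⟨l, hl, rfl⟩ := hx
        obtain ⟨l', hl', rfl⟩ := hy
        rw [← wordProd_append, theta_wordProd, theta_wordProd, theta_wordProd, wordSign_append,
          wordProd_append, smul_mul_smul_comm, smul_smul, Set.mem_ofPred.1 hl,
          Set.mem_ofPred.1 hl', bicocycle]
        congr 1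
        -- The cocycle appears a second time through the sign of the concatenated word; the squares
        -- are `1`.
        linear_combination (-(wordSign l * wordSign l') * cocycle T T' * cocycle T T') *
          cocycle_mul_self S S' - (wordSign l * wordSign l') * cocycle_mul_self T T'
      | zero_left y hy => simp
      | zero_right x hx => simp
      | add_left x y z hx hy hz h h' => simp only [add_mul, map_add, h, h', smul_add]
      | add_right x y z hx hy hz h h' => simp only [mul_add, map_add, h, h', smul_add]
      | smul_left r x y hx hy h =>
        simp only [map_smul, smul_mul_assoc, h]
        rw [smul_comm]
      | smul_right r x y hx hy h =>
        simp only [map_smul, mul_smul_comm, h]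
        rw [smul_comm]
    exact key x hx.mem_span y hy.mem_span

/-- Words are products of letters, all bihomogeneous, and the cocycle never vanishes. The product
rule therefore determines a twist on all words from its values on letters. -/
theorem IsTwist.eq_theta {N : ℕ} {θ : PolO N ≃ₗ[ℂ] PolObar N} (h : IsTwist θ) : θ = theta N := by
  have hw : ∀ l, θ (wordProd (uO N) l) = theta N (wordProd (uO N) l) := by
    intro l
    induction l with
    | nil => exact h.map_one.trans (isTwist_theta N).map_one.symm
    | cons p l ih =>
      have h1 : wordProd (uO N) (p :: l) = wordProd (uO N) [p] * wordProd (uO N) l :=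
        wordProd_append (uO N) [p] l
      have h2 := h.map_mul _ _ _ _ _ _ (hasBidegree_wordProd [p]) (hasBidegree_wordProd l)
      have h3 := (isTwist_theta N).map_mul _ _ _ _ _ _ (hasBidegree_wordProd [p])
        (hasBidegree_wordProd l)
      have h4 : θ (wordProd (uO N) [p]) = theta N (wordProd (uO N) [p]) := by
        rw [wordProd_singleton, h.map_coord, (isTwist_theta N).map_coord]
      rw [ih, h4, h3, ← h1] at h2
      exact (smul_right_injective _
        (mul_ne_zero (cocycle_ne_zero _ _) (cocycle_ne_zero _ _)) h2).symm
  apply LinearEquiv.toLinearMap_injective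
  refine LinearMap.ext_on (span_wordProd_uO N) ?_
  rintro _ ⟨l, rfl⟩
  exact hw l

/-! ### The comultiplication and the counit -/

/-- Joint injectivity of tensor products of linear forms. -/
theorem eq_zero_of_forall_map_eq_zero {V W X Y : Type*} [AddCommMonoid V] [AddCommMonoid W]
    [Module ℂ V] [Module ℂ W] [Module.Free ℂ W] {f : X → V →ₗ[ℂ] ℂ} {f' : Y → W →ₗ[ℂ] ℂ}
    (hf : ∀ v, (∀ x, f x v = 0) → v = 0) (hf' : ∀ w, (∀ y, f' y w = 0) → w = 0)
    (z : V ⊗[ℂ] W)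
    (hz : ∀ x y, LinearMap.mul' ℂ ℂ (TensorProduct.map (f x) (f' y) z) = 0) : z = 0 := by
  -- Write `z = ∑ c_i ⊗ b_i`. For each `x` the vector `∑ f_x(c_i) b_i` is killed by every `f'_y`, so
  -- it vanishes; hence all `f_x(c_i)` are `0`, and then all `c_i`.
  let b := Module.Free.chooseBasis ℂ W
  obtain ⟨c, rfl⟩ := (TensorProduct.equivFinsuppOfBasisRight (M := V) b).symm.surjective z
  have hc : c = 0 := by
    ext i
    refine hf _ fun x => ?_
    have h1 : (c.sum fun i v => f x v • b i) = 0 := by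
      refine hf' _ fun y => ?_
      rw [← hz x y, TensorProduct.equivFinsuppOfBasisRight_symm_apply, Finsupp.sum, Finsupp.sum,
        map_sum, map_sum, map_sum]
      refine Finset.sum_congr rfl fun j _ => ?_
      rw [map_smul, TensorProduct.map_tmul, LinearMap.mul'_apply, smul_eq_mul]
    have h2 := b.linearIndependent
    rw [linearIndependent_iff'ₛ] at h2
    by_cases hi : i ∈ c.support
    · exact h2 c.support (fun i => f x (c i)) (fun _ => 0) (by simpa [Finsupp.sum] using h1) i hi
    · rw [Finsupp.notMem_support_iff.1 hi, map_zero]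
  rw [hc, map_zero]

theorem list_prod_ofFn_sum {A : Type*} [Ring A] [Algebra ℂ A] {κ : Type*} [Fintype κ]
    [DecidableEq κ] {m : ℕ} (f : Fin m → κ → A) :
    (List.ofFn fun t => ∑ k, f t k).prod = ∑ k : Fin m → κ, (List.ofFn fun t => f t (k t)).prod := by
  have h := (MultilinearMap.mkPiAlgebraFin ℂ m A).map_sum f
  simpa only [MultilinearMap.mkPiAlgebraFin_apply] using h

theorem list_prod_ofFn_tmul {A B : Type*} [Ring A] [Algebra ℂ A] [Ring B] [Algebra ℂ B] {m : ℕ}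
    (x : Fin m → A) (y : Fin m → B) : (List.ofFn fun t => x t ⊗ₜ[ℂ] y t).prod =
      (List.ofFn x).prod ⊗ₜ[ℂ] (List.ofFn y).prod := by
  induction m with
  | zero => rfl
  | succ m ih =>
    rw [List.ofFn_succ, List.ofFn_succ, List.ofFn_succ, List.prod_cons, List.prod_cons,
      List.prod_cons, ih, Algebra.TensorProduct.tmul_mul_tmul]

/-- The word with given row and column indices. -/
def word {N m : ℕ} (i j : Fin m → Fin N) : List (Fin N × Fin N) := List.ofFn fun t => (i t, j t)

theorem exists_word {N : ℕ} (l : List (Fin N × Fin N)) :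
    ∃ (m : ℕ) (i j : Fin m → Fin N), l = word i j :=
  ⟨l.length, fun t => (l.get t).1, fun t => (l.get t).2, (List.ofFn_get l).symm⟩

theorem wordProd_word {N m : ℕ} {B : Type*} [Monoid B] (x : Matrix (Fin N) (Fin N) B)
    (i j : Fin m → Fin N) : wordProd x (word i j) = (List.ofFn fun t => x (i t) (j t)).prod := by
  rw [wordProd, word, List.map_ofFn]
  rfl

theorem wordSign_word {N m : ℕ} (i j : Fin m → Fin N) :
    wordSign (word i j) = listSign (List.ofFn i) * listSign (List.ofFn j) := by
  rw [wordSign, word, List.map_ofFn, List.map_ofFn]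
  rfl

theorem theta_symm_wordProd {N : ℕ} (l : List (Fin N × Fin N)) :
    (theta N).symm (wordProd (ubar N) l) = wordSign l • wordProd (uO N) l := by
  rw [LinearEquiv.symm_apply_eq, map_smul, theta_wordProd, smul_smul, wordSign_mul_self, one_smul]

/-- The linear form on `PolObar N` which corresponds to the evaluation at a point of `O_N`. -/
noncomputable def evalBar {N : ℕ} (g : O N) : PolObar N →ₗ[ℂ] ℂ :=
  (evalHom g).toLinearMap ∘ₗ (theta N).symm.toLinearMap

theorem evalBar_theta {N : ℕ} (g : O N) (x : PolO N) : evalBar g (theta N x) = evalHom g x :=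
  congrArg (evalHom g) ((theta N).symm_apply_apply x)

theorem evalBar_wordProd {N : ℕ} (g : O N) (l : List (Fin N × Fin N)) :
    evalBar g (wordProd (ubar N) l) =
      wordSign l * wordProd ((g : Matrix (Fin N) (Fin N) ℝ).map Complex.ofReal) l := by
  change evalHom g ((theta N).symm _) = _
  rw [theta_symm_wordProd, map_smul, map_wordProd]
  rfl

theorem eq_zero_of_evalBar {N : ℕ} (x : PolObar N) (h : ∀ g : O N, evalBar g x = 0) : x = 0 := by
  have h1 : (theta N).symm x = 0 := PolO.ext fun g => by rw [map_zero]; exact h g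
  rwa [LinearEquiv.map_eq_zero_iff] at h1

/-- The linear form on `PolObar N ⊗ PolObar N` which corresponds to the evaluation at a point of
`O_N × O_N`. -/
noncomputable def evalBar₂ {N : ℕ} (g h : O N) : PolObar N ⊗[ℂ] PolObar N →ₗ[ℂ] ℂ :=
  LinearMap.mul' ℂ ℂ ∘ₗ TensorProduct.map (evalBar g) (evalBar h)

theorem evalBar₂_tmul {N : ℕ} (g h : O N) (x y : PolObar N) :
    evalBar₂ g h (x ⊗ₜ y) = evalBar g x * evalBar h y := rfl

theorem free_polObar (N : ℕ) : Module.Free ℂ (PolObar N) := Module.Free.of_divisionRing ℂ _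

/-- The tensor square embeds in the functions on `O_N × O_N`, so identities in it may be checked at
pairs of points. -/
theorem ext_evalBar₂ {N : ℕ} {z z' : PolObar N ⊗[ℂ] PolObar N}
    (h : ∀ g h : O N, evalBar₂ g h z = evalBar₂ g h z') : z = z' := by
  have := free_polObar N
  rw [← sub_eq_zero]
  refine eq_zero_of_forall_map_eq_zero (f := evalBar) (f' := evalBar) eq_zero_of_evalBar
    eq_zero_of_evalBar _ fun x y => ?_
  have h' := h x y
  rw [map_eq_iff_sub] at h'
  exact h'

/-- The matrix `∑ₖ u_{ik} ⊗ u_{kj}`. -/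
noncomputable def comulMat (N : ℕ) : Matrix (Fin N) (Fin N) (PolObar N ⊗[ℂ] PolObar N) :=
  Matrix.of fun i j => ∑ k, ubar N i k ⊗ₜ[ℂ] ubar N k j

theorem wordProd_comulMat {N m : ℕ} (i j : Fin m → Fin N) : wordProd (comulMat N) (word i j) =
    ∑ k : Fin m → Fin N, wordProd (ubar N) (word i k) ⊗ₜ[ℂ] wordProd (ubar N) (word k j) := by
  rw [wordProd_word]
  refine (list_prod_ofFn_sum fun t k => ubar N (i t) k ⊗ₜ[ℂ] ubar N k (j t)).trans ?_
  refine Finset.sum_congr rfl fun k _ => ?_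
  rw [list_prod_ofFn_tmul, wordProd_word, wordProd_word]

/-- The intermediate index list `k` contributes its sign once as columns and once as rows, so the
sign cancels. What remains is the expansion of the entries of the matrix product `g * h`. -/
theorem evalBar₂_comulMat {N : ℕ} (g h : O N) (l : List (Fin N × Fin N)) :
    evalBar₂ g h (wordProd (comulMat N) l) = evalBar (g * h) (wordProd (ubar N) l) := by
  obtain ⟨m, i, j, rfl⟩ := exists_word l
  rw [wordProd_comulMat, map_sum, evalBar_wordProd]
  have h1 : ∀ k : Fin m → Fin N,
      evalBar₂ g h (wordProd (ubar N) (word i k) ⊗ₜ[ℂ] wordProd (ubar N) (word k j)) =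
      wordSign (word i j) * ∏ t, (((g : Matrix (Fin N) (Fin N) ℝ) (i t) (k t) : ℂ) *
        ((h : Matrix (Fin N) (Fin N) ℝ) (k t) (j t) : ℂ)) := by
    intro k
    rw [evalBar₂_tmul, evalBar_wordProd, evalBar_wordProd, wordSign_word, wordSign_word,
      wordSign_word, wordProd_word, wordProd_word, List.prod_ofFn, List.prod_ofFn,
      Finset.prod_mul_distrib]
    simp only [Matrix.map_apply]
    linear_combination (listSign (List.ofFn i) * listSign (List.ofFn j) *
      (∏ t, ((g : Matrix (Fin N) (Fin N) ℝ) (i t) (k t) : ℂ)) *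
      ∏ t, ((h : Matrix (Fin N) (Fin N) ℝ) (k t) (j t) : ℂ)) * listSign_mul_self (List.ofFn k)
  rw [Finset.sum_congr rfl fun k _ => h1 k, ← Finset.mul_sum, wordProd_word, List.prod_ofFn]
  congr 1
  rw [← Fintype.prod_sum fun (t : Fin m) (k : Fin N) =>
    (((g : Matrix (Fin N) (Fin N) ℝ) (i t) k : ℂ) *
        ((h : Matrix (Fin N) (Fin N) ℝ) k (j t) : ℂ))]
  refine Finset.prod_congr rfl fun t _ => ?_
  rw [Matrix.map_apply, Submonoid.coe_mul, Matrix.mul_apply]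
  push_cast
  rfl

/-- The value at `x` is characterised by its evaluations at pairs of points, and it exists on words.
Its uniqueness yields linearity, with no relations left to check. -/
theorem exists_comul (N : ℕ) : ∃ Δ : PolObar N →ₗ[ℂ] PolObar N ⊗[ℂ] PolObar N,
    ∀ x, ∀ g h : O N, evalBar₂ g h (Δ x) = evalBar (g * h) x := by
  have h : ∀ x : PolObar N, ∃ z, ∀ g h : O N, evalBar₂ g h z = evalBar (g * h) x := by
    intro x
    have hx : x ∈ Submodule.span ℂ (Set.range (wordProd (ubar N))) := by
      rw [span_wordProd_ubar]; trivial
    induction hx using Submodule.span_induction with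
    | mem x hx =>
      obtain ⟨l, rfl⟩ := hx
      exact ⟨wordProd (comulMat N) l, fun g h => evalBar₂_comulMat g h l⟩
    | zero => exact ⟨0, fun g h => by rw [map_zero, map_zero]⟩
    | add x y _ _ hx hy =>
      obtain ⟨z, hz⟩ := hx
      obtain ⟨z', hz'⟩ := hy
      exact ⟨z + z', fun g h => by rw [map_add, map_add, hz, hz']⟩
    | smul c x _ hx =>
      obtain ⟨z, hz⟩ := hx
      exact ⟨c • z, fun g h => by rw [map_smul, map_smul, hz]⟩
  choose Δ hΔ using h
  exact ⟨{ toFun := Δ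
           map_add' := fun x y => ext_evalBar₂ fun g h => by
             rw [map_add, hΔ, hΔ, hΔ, map_add]
           map_smul' := fun c x => ext_evalBar₂ fun g h => by
             rw [map_smul, hΔ, hΔ, map_smul, RingHom.id_apply] }, hΔ⟩

/-- Words span and are stable under concatenation, so a linear map sending words to words is
multiplicative. -/
theorem linearMap_map_mul {N : ℕ} {A : Type*} [Ring A] [Algebra ℂ A] {f : PolObar N →ₗ[ℂ] A}
    {x : Matrix (Fin N) (Fin N) A} (h : ∀ l, f (wordProd (ubar N) l) = wordProd x l)
    (a b : PolObar N) : f (a * b) = f a * f b := by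
  have ha : a ∈ Submodule.span ℂ (Set.range (wordProd (ubar N))) := by
    rw [span_wordProd_ubar]; trivial
  have hb : b ∈ Submodule.span ℂ (Set.range (wordProd (ubar N))) := by
    rw [span_wordProd_ubar]; trivial
  induction ha, hb using Submodule.span_induction₂ with
  | mem_mem x y hx hy =>
    obtain ⟨l, rfl⟩ := hx
    obtain ⟨l', rfl⟩ := hy
    rw [← wordProd_append, h, h, h, wordProd_append]
  | zero_left y hy => simp
  | zero_right x hx => simp
  | add_left x y z hx hy hz h h' => simp only [add_mul, map_add, h, h']
  | add_right x y z hx hy hz h h' => simp only [mul_add, map_add, h, h']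
  | smul_left r x y hx hy h => simp only [map_smul, smul_mul_assoc, h]
  | smul_right r x y hx hy h => simp only [map_smul, mul_smul_comm, h]

/-- The pointwise formula is kept along with `IsComul`, because it is what compares representations
of `Ō_N` with those of `O_N`. -/
theorem exists_comulHom (N : ℕ) : ∃ Δ : PolObar N →ₐ[ℂ] PolObar N ⊗[ℂ] PolObar N,
    IsComul Δ ∧ ∀ x, ∀ g h : O N, evalBar₂ g h (Δ x) = evalBar (g * h) x := by
  obtain ⟨Δ, hΔ⟩ := exists_comul N
  have hw : ∀ l, Δ (wordProd (ubar N) l) = wordProd (comulMat N) l := fun l =>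
    ext_evalBar₂ fun g h => by rw [hΔ, evalBar₂_comulMat]
  refine ⟨AlgHom.ofLinearMap Δ (hw []) (linearMap_map_mul hw), fun i j => ?_, hΔ⟩
  have h := hw [(i, j)]
  rw [wordProd_singleton, wordProd_singleton] at h
  exact h

/-- The trivial solution of the relations of `Ō_N`. -/
noncomputable def unitSolution (N : ℕ) : Solution N where
  carrier := ℂ
  entry := 1
  rel :=
    { selfAdjoint := fun i j => by rw [Matrix.one_apply]; split_ifs <;> simp
      row_orthogonal := fun i j => by
        simp [Matrix.one_apply]
      col_orthogonal := fun i j => by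
        simp [Matrix.one_apply, eq_comm]
      -- Of two distinct entries in a row or column of the identity matrix, at least one is zero.
      row_anticomm := fun i j l h => by
        by_cases h1 : i = j
        · rw [Matrix.one_apply_ne (h1 ▸ h : i ≠ l)]; simp
        · rw [Matrix.one_apply_ne h1]; simp
      col_anticomm := fun i k j h => by
        by_cases h1 : i = j
        · rw [Matrix.one_apply_ne (h1 ▸ h.symm : k ≠ j)]; simp
        · rw [Matrix.one_apply_ne h1]; simp
      comm := fun i k j l _ _ => mul_comm _ _ }

/-- The counit of `Ō_N`. -/
noncomputable def counitBar (N : ℕ) : PolObar N →ₐ[ℂ] ℂ :=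
  let f : PolObar N →⋆ₐ[ℂ] ℂ := (toSolution (unitSolution N)).comp (polObar N).subtype
  f.toAlgHom

theorem counitBar_ubar {N : ℕ} (i j : Fin N) :
    counitBar N (ubar N i j) = (1 : Matrix (Fin N) (Fin N) ℂ) i j := rfl

theorem isCounit_counitBar (N : ℕ) : IsCounit (counitBar N) := fun i j => by
  rw [counitBar_ubar, Matrix.one_apply]

/-- A word in the identity matrix vanishes unless its row and column lists agree, and then its sign
is a square. -/
theorem wordSign_smul_wordProd_one {N : ℕ} (l : List (Fin N × Fin N)) :
    wordSign l • wordProd (1 : Matrix (Fin N) (Fin N) ℂ) l = wordProd 1 l := by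
  by_cases h : l.map Prod.fst = l.map Prod.snd
  · rw [wordSign, h, listSign_mul_self, one_smul]
  · have h0 : wordProd (1 : Matrix (Fin N) (Fin N) ℂ) l = 0 := by
      obtain ⟨p, hp, hne⟩ : ∃ p ∈ l, p.1 ≠ p.2 := by
        by_contra! hc
        exact h (List.map_congr_left hc)
      rw [wordProd, List.prod_eq_zero_iff, List.mem_map]
      exact ⟨p, hp, Matrix.one_apply_ne hne⟩
    rw [h0, smul_zero]

theorem counitBar_theta {N : ℕ} (x : PolO N) : counitBar N (theta N x) = evalHom 1 x := by
  have h : (counitBar N).toLinearMap ∘ₗ (theta N).toLinearMap = (evalHom 1).toLinearMap := by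
    refine LinearMap.ext_on (span_wordProd_uO N) ?_
    rintro _ ⟨l, rfl⟩
    change counitBar N (theta N _) = evalHom 1 _
    rw [theta_wordProd, map_smul, map_wordProd, map_wordProd]
    have h1 : (ubar N).map (counitBar N) = 1 := rfl
    have h2 : (uO N).map (evalHom 1) = 1 := by
      ext i j
      rw [Matrix.map_apply, evalHom_uO, Matrix.one_apply]
      change (((1 : Matrix (Fin N) (Fin N) ℝ) i j : ℝ) : ℂ) = _
      rw [Matrix.one_apply]
      split_ifs <;> simp
    rw [h1, h2, wordSign_smul_wordProd_one]
  exact LinearMap.congr_fun h x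

/-- The twisting map gives a correspondence between representations. -/
theorem isRep_iff_isCorep {N : ℕ} {Δ : PolObar N →ₐ[ℂ] PolObar N ⊗[ℂ] PolObar N}
    (hΔ : ∀ x, ∀ g h : O N, evalBar₂ g h (Δ x) = evalBar (g * h) x) {n : Type*} [Fintype n]
    [DecidableEq n] (ρ : Matrix n n (PolO N)) :
    IsRep ρ ↔ IsCorep Δ (counitBar N) (ρ.map (theta N)) := by
  have h1 : ∀ i j (g h : O N), evalBar₂ g h (Δ (ρ.map (theta N) i j)) =
      evalO (ρ i j) (g * h) := fun i j g h => by
    rw [hΔ, Matrix.map_apply, evalBar_theta, evalHom_apply]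
  have h2 : ∀ i j (g h : O N), evalBar₂ g h (∑ k, ρ.map (theta N) i k ⊗ₜ[ℂ] ρ.map (theta N) k j) =
      ∑ k, evalO (ρ i k) g * evalO (ρ k j) h := fun i j g h => by
    rw [map_sum]
    refine Finset.sum_congr rfl fun k _ => ?_
    rw [evalBar₂_tmul, Matrix.map_apply, Matrix.map_apply, evalBar_theta, evalBar_theta,
      evalHom_apply, evalHom_apply]
  constructor
  · intro hρ
    refine ⟨fun i j => ext_evalBar₂ fun g h => ?_, fun i j => ?_⟩
    · rw [h1, h2, hρ.mul]
    · rw [Matrix.map_apply, counitBar_theta, evalHom_apply, hρ.one]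
  · intro hw
    refine ⟨fun g h i j => ?_, fun i j => ?_⟩
    · rw [← h1, ← h2, hw.comul]
    · rw [← hw.counit, Matrix.map_apply, counitBar_theta, evalHom_apply]

/-! ### Tensor products of representations -/

section ScalarMul

variable {A : Type*} [Ring A] [Algebra ℂ A] {n m : Type*} [Fintype n] [Fintype m]

theorem map_algebraMap_mul_apply (E : Matrix n n ℂ) (x : Matrix n n A) (i j : n) :
    (E.map (algebraMap ℂ A) * x) i j = ∑ p, E i p • x p j := by
  simp only [Matrix.mul_apply, Matrix.map_apply, Algebra.smul_def]

theorem mul_map_algebraMap_apply (E : Matrix n n ℂ) (x : Matrix n n A) (i j : n) :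
    (x * E.map (algebraMap ℂ A)) i j = ∑ p, E p j • x i p := by
  simp only [Matrix.mul_apply, Matrix.map_apply, Algebra.smul_def, Algebra.commutes]

/-- The Kronecker product of matrices with respect to a bilinear map. -/
def bilinKron {B : Type*} [Ring B] [Algebra ℂ B] (β : A →ₗ[ℂ] A →ₗ[ℂ] B) (x : Matrix n n A)
    (y : Matrix m m A) : Matrix (n × m) (n × m) B :=
  Matrix.of fun p q => β (x p.1 q.1) (y p.2 q.2)

variable {B : Type*} [Ring B] [Algebra ℂ B] (β : A →ₗ[ℂ] A →ₗ[ℂ] B)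

/-- Stated for an arbitrary bilinear map, so as to serve for both `thetaMul` and `mulTheta`. -/
theorem map_kronecker_mul_bilinKron (E : Matrix n n ℂ) (F : Matrix m m ℂ) (x : Matrix n n A)
    (y : Matrix m m A) : (E ⊗ₖ F).map (algebraMap ℂ B) * bilinKron β x y =
      bilinKron β (E.map (algebraMap ℂ A) * x) (F.map (algebraMap ℂ A) * y) := by
  ext p q
  rw [map_algebraMap_mul_apply]
  simp only [bilinKron, Matrix.of_apply]
  rw [map_algebraMap_mul_apply, map_algebraMap_mul_apply]
  simp only [map_sum, LinearMap.sum_apply, map_smul, LinearMap.smul_apply, Finset.smul_sum]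
  rw [Fintype.sum_prod_type, Finset.sum_comm]
  refine Finset.sum_congr rfl fun i _ => Finset.sum_congr rfl fun k _ => ?_
  rw [smul_smul, Matrix.kroneckerMap_apply, mul_comm]

theorem bilinKron_mul_map_kronecker (E : Matrix n n ℂ) (F : Matrix m m ℂ) (x : Matrix n n A)
    (y : Matrix m m A) : bilinKron β x y * (E ⊗ₖ F).map (algebraMap ℂ B) =
      bilinKron β (x * E.map (algebraMap ℂ A)) (y * F.map (algebraMap ℂ A)) := by
  ext p q
  rw [mul_map_algebraMap_apply]
  simp only [bilinKron, Matrix.of_apply]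
  rw [mul_map_algebraMap_apply, mul_map_algebraMap_apply]
  simp only [map_sum, LinearMap.sum_apply, map_smul, LinearMap.smul_apply, Finset.smul_sum]
  rw [Fintype.sum_prod_type, Finset.sum_comm]
  refine Finset.sum_congr rfl fun i _ => Finset.sum_congr rfl fun k _ => ?_
  rw [smul_smul, Matrix.kroneckerMap_apply, mul_comm]

end ScalarMul

theorem signDiag_mul {N : ℕ} (d e : Fin N → ℤˣ) : signDiag (d * e) = signDiag d * signDiag e := by
  apply Subtype.ext
  change Matrix.diagonal _ = Matrix.diagonal _ * Matrix.diagonal _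
  rw [Matrix.diagonal_mul_diagonal]
  congr 1
  funext i
  simp

theorem signDiag_one {N : ℕ} : signDiag (1 : Fin N → ℤˣ) = 1 := by
  apply Subtype.ext
  change Matrix.diagonal _ = (1 : Matrix (Fin N) (Fin N) ℝ)
  rw [← Matrix.diagonal_one]
  congr 1
  funext i
  simp

/-- The sum over subsets expands `∏ (1 + d_i)`, which has a zero factor as soon as some `d_i = -1`.
-/
theorem sum_signChar_sets {N : ℕ} (d : Fin N → ℤˣ) :
    ∑ S, signChar S d = if d = 1 then (2 : ℂ) ^ N else 0 := by
  have h : ∑ S, signChar S d = ∏ i, (1 + ((d i : ℤ) : ℂ)) := by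
    rw [Finset.prod_one_add, Finset.powerset_univ]
    rfl
  rw [h]
  split_ifs with hd
  · subst hd
    norm_num
  · obtain ⟨i, hi⟩ := Function.ne_iff.1 hd
    refine Finset.prod_eq_zero (Finset.mem_univ i) ?_
    have : d i = -1 := (Int.units_eq_one_or (d i)).resolve_left hi
    rw [this]
    norm_num

section Rep

variable {N : ℕ} {n m : Type*} [Fintype n] [Fintype m]

/-- The projection onto an isotypic component for the action of the diagonal sign matrices. -/
noncomputable def isotypic (ρ : Matrix n n (PolO N)) (S : Finset (Fin N)) : Matrix n n ℂ :=
  ((2 : ℂ) ^ N)⁻¹ • ∑ d, signChar S d • ρ.map (evalHom (signDiag d))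

/-- The component of a representation between two isotypic components. -/
noncomputable def component (ρ : Matrix n n (PolO N)) (S T : Finset (Fin N)) :
    Matrix n n (PolO N) :=
  (isotypic ρ S).map (algebraMap ℂ (PolO N)) * ρ * (isotypic ρ T).map (algebraMap ℂ (PolO N))

theorem map_evalHom_component (ρ : Matrix n n (PolO N)) (S T : Finset (Fin N)) (g : O N) :
    (component ρ S T).map (evalHom g) = isotypic ρ S * ρ.map (evalHom g) * isotypic ρ T := by
  have h : ∀ E : Matrix n n ℂ, (E.map (algebraMap ℂ (PolO N))).map (evalHom g) = E := by
    intro E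
    ext i j
    exact (evalHom g).commutes (E i j)
  rw [component, Matrix.map_mul, Matrix.map_mul, h, h]

theorem map_kronecker_mul_mul (β : PolO N →ₗ[ℂ] PolO N →ₗ[ℂ] PolObar N)
    (ρ : Matrix n n (PolO N)) (τ : Matrix m m (PolO N)) (S T S' T' : Finset (Fin N)) :
    (isotypic ρ S ⊗ₖ isotypic τ T).map (algebraMap ℂ (PolObar N)) * bilinKron β ρ τ *
      (isotypic ρ S' ⊗ₖ isotypic τ T').map (algebraMap ℂ (PolObar N)) =
      bilinKron β (component ρ S S') (component τ T T') := by
  rw [map_kronecker_mul_bilinKron, bilinKron_mul_map_kronecker]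
  rfl

variable [DecidableEq n] [DecidableEq m]

theorem IsRep.map_mul {ρ : Matrix n n (PolO N)} (hρ : IsRep ρ) (g h : O N) :
    ρ.map (evalHom (g * h)) = ρ.map (evalHom g) * ρ.map (evalHom h) := by
  ext i j
  rw [Matrix.mul_apply]
  exact hρ.mul g h i j

theorem IsRep.map_one {ρ : Matrix n n (PolO N)} (hρ : IsRep ρ) : ρ.map (evalHom 1) = 1 := by
  ext i j
  rw [Matrix.one_apply]
  exact hρ.one i j

theorem isotypic_mul {ρ : Matrix n n (PolO N)} (hρ : IsRep ρ) (S : Finset (Fin N))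
    (e : Fin N → ℤˣ) :
    isotypic ρ S * ρ.map (evalHom (signDiag e)) = signChar S e • isotypic ρ S := by
  rw [isotypic, Matrix.smul_mul, Finset.sum_mul, smul_comm (signChar S e),
    Finset.smul_sum (r := signChar S e)]
  congr 1
  refine Fintype.sum_equiv (Equiv.mulRight e) _ _ fun d => ?_
  rw [Matrix.smul_mul, ← hρ.map_mul, ← signDiag_mul, Equiv.coe_mulRight, smul_smul, signChar_mul]
  congr 1
  linear_combination -signChar S d * signChar_mul_self S e

theorem mul_isotypic {ρ : Matrix n n (PolO N)} (hρ : IsRep ρ) (S : Finset (Fin N))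
    (e : Fin N → ℤˣ) :
    ρ.map (evalHom (signDiag e)) * isotypic ρ S = signChar S e • isotypic ρ S := by
  rw [isotypic, Matrix.mul_smul, Finset.mul_sum, smul_comm (signChar S e),
    Finset.smul_sum (r := signChar S e)]
  congr 1
  refine Fintype.sum_equiv (Equiv.mulLeft e) _ _ fun d => ?_
  rw [Matrix.mul_smul, ← hρ.map_mul, ← signDiag_mul, Equiv.coe_mulLeft, smul_smul, signChar_mul]
  congr 1
  linear_combination -signChar S d * signChar_mul_self S e

theorem isotypic_mul_isotypic {ρ : Matrix n n (PolO N)} (hρ : IsRep ρ) (S T : Finset (Fin N)) :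
    isotypic ρ S * isotypic ρ T = if S = T then isotypic ρ S else 0 := by
  have h : isotypic ρ T = ((2 : ℂ) ^ N)⁻¹ • ∑ d, signChar T d • ρ.map (evalHom (signDiag d)) := rfl
  rw [h, Matrix.mul_smul, Finset.mul_sum]
  simp only [Matrix.mul_smul, isotypic_mul hρ, smul_smul]
  rw [← Finset.sum_smul]
  have h2 := sum_signChar_mul S T
  simp only [mul_comm (signChar S _)] at h2
  rw [h2, smul_smul]
  split_ifs
  · rw [inv_mul_cancel₀ (pow_ne_zero _ two_ne_zero), one_smul]
  · simp

/-- Summing the characters over `S` leaves only the term of the identity sign matrix, which acts as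
`1`. -/
theorem sum_isotypic {ρ : Matrix n n (PolO N)} (hρ : IsRep ρ) : ∑ S, isotypic ρ S = 1 := by
  simp only [isotypic]
  rw [← Finset.smul_sum, Finset.sum_comm]
  simp only [← Finset.sum_smul, sum_signChar_sets, ite_smul, zero_smul]
  rw [Finset.sum_ite_eq', if_pos (Finset.mem_univ _), signDiag_one, hρ.map_one, smul_smul,
    inv_mul_cancel₀ (pow_ne_zero _ two_ne_zero), one_smul]

/-- A sign matrix acts by the scalar `signChar S d` on an isotypic component, so on either side it
can be absorbed by the projection. -/
theorem hasBidegree_component {ρ : Matrix n n (PolO N)} (hρ : IsRep ρ) (S T : Finset (Fin N))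
    (i j : n) : HasBidegree S T (component ρ S T i j) := by
  intro d e g
  have h : (component ρ S T).map (evalHom (signDiag d * g * signDiag e)) =
      (signChar S d * signChar T e) • (component ρ S T).map (evalHom g) := by
    rw [map_evalHom_component, map_evalHom_component, hρ.map_mul, hρ.map_mul]
    simp only [Matrix.mul_assoc]
    rw [mul_isotypic hρ, ← Matrix.mul_assoc, isotypic_mul hρ]
    simp only [Matrix.mul_smul, Matrix.smul_mul, smul_smul]
    rw [mul_comm (signChar T e)]
  exact congrFun (congrFun h i) j

/-- The bilinear map `(x, y) ↦ θ(x y)`. -/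
noncomputable def thetaMul (N : ℕ) : PolO N →ₗ[ℂ] PolO N →ₗ[ℂ] PolObar N :=
  LinearMap.compr₂ (LinearMap.mul ℂ (PolO N)) (theta N).toLinearMap

/-- The bilinear map `(x, y) ↦ θ(x) θ(y)`. -/
noncomputable def mulTheta (N : ℕ) : PolO N →ₗ[ℂ] PolO N →ₗ[ℂ] PolObar N :=
  LinearMap.compl₁₂ (LinearMap.mul ℂ (PolObar N)) (theta N).toLinearMap (theta N).toLinearMap

theorem bilinKron_component {ρ : Matrix n n (PolO N)} {τ : Matrix m m (PolO N)} (hρ : IsRep ρ)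
    (hτ : IsRep τ) (S T S' T' : Finset (Fin N)) :
    bilinKron (mulTheta N) (component ρ S T) (component τ S' T') =
      (cocycle S S' * cocycle T T') •
        bilinKron (thetaMul N) (component ρ S T) (component τ S' T') := by
  refine Matrix.ext fun p q => ?_
  exact (isTwist_theta N).map_mul _ _ _ _ _ _ (hasBidegree_component hρ S T _ _)
    (hasBidegree_component hτ S' T' _ _)

/-- The intertwiner between the twist of a tensor product and the tensor product of twists. -/
noncomputable def intertwiner (ρ : Matrix n n (PolO N)) (τ : Matrix m m (PolO N)) :
    Matrix (n × m) (n × m) ℂ :=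
  ∑ S, ∑ T, cocycle S T • (isotypic ρ S ⊗ₖ isotypic τ T)

theorem intertwiner_mul_kronecker {ρ : Matrix n n (PolO N)} {τ : Matrix m m (PolO N)}
    (hρ : IsRep ρ) (hτ : IsRep τ) (S T : Finset (Fin N)) :
    intertwiner ρ τ * (isotypic ρ S ⊗ₖ isotypic τ T) =
      cocycle S T • (isotypic ρ S ⊗ₖ isotypic τ T) := by
  simp only [intertwiner, Finset.sum_mul, Matrix.smul_mul, ← Matrix.mul_kronecker_mul,
    isotypic_mul_isotypic hρ, isotypic_mul_isotypic hτ]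
  rw [Finset.sum_eq_single S (fun S' _ h => by simp [h]) (by simp),
    Finset.sum_eq_single T (fun T' _ h => by simp [h]) (by simp), if_pos rfl, if_pos rfl]

theorem sum_kronecker_isotypic {ρ : Matrix n n (PolO N)} {τ : Matrix m m (PolO N)}
    (hρ : IsRep ρ) (hτ : IsRep τ) : ∑ S, ∑ T, isotypic ρ S ⊗ₖ isotypic τ T = 1 := by
  rw [← Matrix.one_kronecker_one, ← sum_isotypic hρ, ← sum_isotypic hτ]
  ext p q
  simp only [Matrix.sum_apply, Matrix.kroneckerMap_apply, Finset.sum_mul_sum]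

/-- The intertwiner acts by the sign `cocycle S T` on the summands of a decomposition of the
identity. -/
theorem intertwiner_mul_self {ρ : Matrix n n (PolO N)} {τ : Matrix m m (PolO N)} (hρ : IsRep ρ)
    (hτ : IsRep τ) : intertwiner ρ τ * intertwiner ρ τ = 1 := by
  conv_lhs => enter [2]; rw [intertwiner]
  simp only [Finset.mul_sum, Matrix.mul_smul, intertwiner_mul_kronecker hρ hτ, smul_smul,
    cocycle_mul_self, one_smul]
  exact sum_kronecker_isotypic hρ hτ

theorem map_intertwiner (ρ : Matrix n n (PolO N)) (τ : Matrix m m (PolO N)) :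
    (intertwiner ρ τ).map (algebraMap ℂ (PolObar N)) = ∑ S, ∑ T,
      cocycle S T • (isotypic ρ S ⊗ₖ isotypic τ T).map (algebraMap ℂ (PolObar N)) := by
  change (Algebra.ofId ℂ (PolObar N)).mapMatrix (intertwiner ρ τ) = _
  rw [intertwiner]
  simp only [map_sum, map_smul]
  rfl

theorem sum_map_kronecker {ρ : Matrix n n (PolO N)} {τ : Matrix m m (PolO N)} (hρ : IsRep ρ)
    (hτ : IsRep τ) : ∑ S, ∑ T,
      (isotypic ρ S ⊗ₖ isotypic τ T).map (algebraMap ℂ (PolObar N)) = 1 := by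
  have h := congrArg (Algebra.ofId ℂ (PolObar N)).mapMatrix (sum_kronecker_isotypic hρ hτ)
  simp only [map_sum, _root_.map_one] at h
  exact h

/-- The twisting map is compatible with the tensor products of representations. -/
theorem corepEquiv_kronecker {ρ : Matrix n n (PolO N)} {τ : Matrix m m (PolO N)} (hρ : IsRep ρ)
    (hτ : IsRep τ) :
    CorepEquiv ((ρ ⊗ₖ τ).map (theta N)) (ρ.map (theta N) ⊗ₖ τ.map (theta N)) := by
  have hsq := intertwiner_mul_self hρ hτ
  refine ⟨intertwiner ρ τ, ⟨⟨_, _, hsq, hsq⟩, rfl⟩, ?_⟩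
  have h1 : (ρ ⊗ₖ τ).map (theta N) = bilinKron (thetaMul N) ρ τ := rfl
  have h2 : ρ.map (theta N) ⊗ₖ τ.map (theta N) = bilinKron (mulTheta N) ρ τ := rfl
  -- The decomposition of the identity is inserted on the side where the intertwiner is absent, so
  -- that both sides become sums over pairs of isotypic components.
  rw [h1, h2, ← Matrix.mul_one (_ * bilinKron (thetaMul N) ρ τ),
    ← Matrix.one_mul (bilinKron (mulTheta N) ρ τ * _), ← sum_map_kronecker hρ hτ, map_intertwiner,
    ← Matrix.mul_assoc]
  simp only [Finset.sum_mul, Finset.mul_sum, Matrix.smul_mul, Matrix.mul_smul,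
    map_kronecker_mul_mul, bilinKron_component hρ hτ, smul_smul]
  refine Finset.sum_congr rfl fun S _ => Finset.sum_congr rfl fun T _ =>
    Finset.sum_congr rfl fun S' _ => Finset.sum_congr rfl fun T' _ => ?_
  congr 1
  -- On the right, the sign of the intertwiner also occurs in `bilinKron_component`, and the two
  -- cancel; the other factor of `bilinKron_component` is the sign on the left.
  linear_combination -cocycle S' T' * cocycle_mul_self S T

end Rep

/-! ### The coefficients of the coaction -/

theorem cubeElt_injective {N : ℕ} : Function.Injective (cubeElt (N := N)) := by
  intro A B h
  ext a
  have h1 := congrArg Multiplicative.toAdd (congrFun h a)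
  simp only [cubeElt, toAdd_ofAdd] at h1
  by_cases hA : a ∈ A <;> by_cases hB : a ∈ B <;> simp_all

theorem cubeElt_symmDiff {N : ℕ} (A B : Finset (Fin N)) :
    cubeElt (A ∆ B) = cubeElt A * cubeElt B := by
  funext a
  change Multiplicative.ofAdd (if a ∈ A ∆ B then (1 : ZMod 2) else 0) =
    Multiplicative.ofAdd ((if a ∈ A then (1 : ZMod 2) else 0) + if a ∈ B then 1 else 0)
  by_cases hA : a ∈ A <;> by_cases hB : a ∈ B <;> simp [Finset.mem_symmDiff, hA, hB]
  rfl

theorem cubeElt_empty {N : ℕ} : cubeElt (∅ : Finset (Fin N)) = 1 := rfl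

theorem cubeElt_parity {N : ℕ} (l : List (Fin N)) :
    cubeElt (parity l) = (l.map fun a => cubeElt {a}).prod := by
  induction l with
  | nil => rfl
  | cons a l ih => rw [parity, cubeElt_symmDiff, ih, List.map_cons, List.prod_cons]

/-- The coefficient of a group element. -/
noncomputable def cubeCoeff {N : ℕ} (c : Cube N) :
    PolObar N ⊗[ℂ] MonoidAlgebra ℂ (Cube N) →ₗ[ℂ] PolObar N :=
  (TensorProduct.rid ℂ (PolObar N)).toLinearMap ∘ₗ
    ((Finsupp.lapply c : (Cube N →₀ ℂ) →ₗ[ℂ] ℂ) ∘ₗ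
        (MonoidAlgebra.coeffLinearEquiv ℂ).toLinearMap).lTensor (PolObar N)

theorem cubeCoeff_tmul_of {N : ℕ} (c c' : Cube N) (x : PolObar N) :
    cubeCoeff c (x ⊗ₜ MonoidAlgebra.of ℂ (Cube N) c') = if c' = c then x else 0 := by
  have h : cubeCoeff c (x ⊗ₜ MonoidAlgebra.of ℂ (Cube N) c') =
      (Finsupp.single c' (1 : ℂ) c) • x := rfl
  rw [h, Finsupp.single_apply]
  split_ifs <;> simp

theorem coactCoeff_eq_cubeCoeff {N : ℕ} (A B : Finset (Fin N)) :
    coactCoeff A B =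
      cubeCoeff (cubeElt B) (coaction N (MonoidAlgebra.of ℂ (Cube N) (cubeElt A))) := rfl

theorem coaction_cubeElt_parity {N : ℕ} (l : List (Fin N)) :
    coaction N (MonoidAlgebra.of ℂ (Cube N) (cubeElt (parity l))) = (l.map (coactGen N)).prod := by
  rw [cubeElt_parity, map_list_prod, map_list_prod, List.map_map, List.map_map]
  congr 1
  refine List.map_congr_left fun a _ => ?_
  exact coaction_gen N a

/-- Expand the product of the elements `∑_b ū_{ab} ⊗ g_b` over all choices `k` of the indices `b`;
the group element obtained depends only on the parity of `k`. -/
theorem coactCoeff_parity {N r : ℕ} (f : Fin r → Fin N) (B : Finset (Fin N)) :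
    coactCoeff (parity (List.ofFn f)) B = ∑ k : Fin r → Fin N,
      if parity (List.ofFn k) = B then wordProd (ubar N) (word f k) else 0 := by
  rw [coactCoeff_eq_cubeCoeff, coaction_cubeElt_parity, List.map_ofFn]
  have h := list_prod_ofFn_sum fun (t : Fin r) (b : Fin N) =>
    ubar N (f t) b ⊗ₜ[ℂ] MonoidAlgebra.of ℂ (Cube N) (cubeElt {b})
  refine (congrArg _ h).trans ?_
  rw [map_sum]
  refine Finset.sum_congr rfl fun k _ => ?_
  have h2 : (List.ofFn fun t => MonoidAlgebra.of ℂ (Cube N) (cubeElt {k t})).prod =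
      MonoidAlgebra.of ℂ (Cube N) (cubeElt (parity (List.ofFn k))) := by
    rw [cubeElt_parity, map_list_prod, List.map_map, List.map_ofFn]
    rfl
  rw [list_prod_ofFn_tmul, h2, cubeCoeff_tmul_of, wordProd_word]
  exact if_congr cubeElt_injective.eq_iff rfl rfl

theorem wordProd_ubar_eq_theta {N : ℕ} (l : List (Fin N × Fin N)) :
    wordProd (ubar N) l = theta N (wordSign l • wordProd (uO N) l) := by
  rw [map_smul, theta_wordProd, smul_smul, wordSign_mul_self, one_smul]

theorem parity_ofFn_comp_perm {N r : ℕ} {A : Finset (Fin N)} (hA : A.card = r)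
    (σ : Equiv.Perm (Fin r)) :
    parity (List.ofFn fun t => A.orderEmbOfFin hA (σ t)) = A := by
  rw [parity_ofFn_of_injective (k := fun t => A.orderEmbOfFin hA (σ t))
    ((A.orderEmbOfFin hA).injective.comp σ.injective)]
  ext x
  rw [← Finset.mem_coe, ← Finset.mem_coe, ← Finset.range_orderEmbOfFin A hA]
  simp only [Finset.coe_image, Finset.coe_univ, Set.image_univ]
  rw [Set.mem_range, Set.mem_range]
  exact ⟨fun ⟨t, ht⟩ => ⟨σ t, ht⟩, fun ⟨t, ht⟩ => ⟨σ.symm t, by simpa using ht⟩⟩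

theorem exists_perm_of_parity_eq {N r : ℕ} {B : Finset (Fin N)} (hB : B.card = r)
    {k : Fin r → Fin N} (hk : Function.Injective k) (h : parity (List.ofFn k) = B) :
    ∃ σ : Equiv.Perm (Fin r), (fun t => B.orderEmbOfFin hB (σ t)) = k := by
  rw [parity_ofFn_of_injective hk] at h
  have h1 : ∀ t, ∃ s, B.orderEmbOfFin hB s = k t := by
    intro t
    have : k t ∈ Set.range (B.orderEmbOfFin hB) := by
      rw [Finset.range_orderEmbOfFin, ← h]
      simp
    exact this
  choose s hs using h1
  have hinj : Function.Injective s := fun x y hxy => hk (by rw [← hs, ← hs, hxy])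
  exact ⟨Equiv.ofBijective s (Finite.injective_iff_bijective.1 hinj), funext hs⟩

/-- The minors of the matrix of coordinates of `O_N`. -/
noncomputable def minor {N r : ℕ} (a b : Fin r → Fin N) : PolO N :=
  ((uO N).submatrix a b).det

theorem minor_comp_perm {N r : ℕ} (a b : Fin r → Fin N) (σ : Equiv.Perm (Fin r)) :
    minor a (fun t => b (σ t)) = ((Equiv.Perm.sign σ : ℤ) : PolO N) * minor a b :=
  Matrix.det_permute' σ ((uO N).submatrix a b)

theorem minor_eq_zero {N r : ℕ} (a : Fin r → Fin N) {b : Fin r → Fin N}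
    (hb : ¬Function.Injective b) : minor a b = 0 := by
  rw [Function.not_injective_iff] at hb
  obtain ⟨s, t, hst, hne⟩ := hb
  exact Matrix.det_zero_of_column_eq hne fun i => by simp [hst]

theorem minor_eq_sum {N r : ℕ} (a b : Fin r → Fin N) : minor a b =
    ∑ σ : Equiv.Perm (Fin r), ((Equiv.Perm.sign σ : ℤ) : ℂ) •
      wordProd (uO N) (word (fun t => a (σ t)) b) := by
  rw [minor, Matrix.det_apply']
  refine Finset.sum_congr rfl fun σ _ => ?_
  rw [wordProd_word, List.prod_ofFn, Algebra.smul_def, map_intCast]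
  rfl

/-- All `r!` orderings of `A` give the same `g_A`, hence the same coefficient. Under `θ⁻¹` the word
for the row ordering `σ` carries the sign of `σ`, so adding the orderings produces minors. -/
theorem factorial_smul_coactCoeff {N r : ℕ} {A : Finset (Fin N)} (hA : A.card = r)
    (B : Finset (Fin N)) : (r.factorial : ℂ) • coactCoeff A B =
      theta N (∑ k : Fin r → Fin N, if parity (List.ofFn k) = B then
        listSign (List.ofFn k) • minor (A.orderEmbOfFin hA) k else 0) := by
  have h1 : ∀ σ : Equiv.Perm (Fin r), coactCoeff A B =
      theta N (∑ k : Fin r → Fin N, if parity (List.ofFn k) = B then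
        listSign (List.ofFn k) • ((Equiv.Perm.sign σ : ℤ) : ℂ) •
          wordProd (uO N) (word (fun t => A.orderEmbOfFin hA (σ t)) k) else 0) := by
    intro σ
    have h := coactCoeff_parity (fun t => A.orderEmbOfFin hA (σ t)) B
    rw [parity_ofFn_comp_perm hA σ] at h
    rw [h, map_sum]
    refine Finset.sum_congr rfl fun k _ => ?_
    split_ifs
    · rw [wordProd_ubar_eq_theta, wordSign_word, listSign_ofFn_comp_perm, mul_comm, mul_smul]
    · rw [map_zero]
  have h2 : (r.factorial : ℂ) • coactCoeff A B = ∑ _σ : Equiv.Perm (Fin r), coactCoeff A B := by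
    rw [Finset.sum_const, Finset.card_univ, Fintype.card_perm, Fintype.card_fin,
      Nat.cast_smul_eq_nsmul]
  rw [h2, Finset.sum_congr rfl fun σ _ => h1 σ, ← map_sum, Finset.sum_comm]
  congr 1
  refine Finset.sum_congr rfl fun k _ => ?_
  split_ifs
  · rw [minor_eq_sum, Finset.smul_sum]
  · simp

theorem factorial_ne_zero' (r : ℕ) : (r.factorial : ℂ) ≠ 0 :=
  Nat.cast_ne_zero.2 r.factorial_ne_zero

/-- An index list with a repetition gives a minor with two equal columns, and one without repetition
has a parity of cardinality `A.card`. -/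
theorem coactCoeff_eq_zero {N : ℕ} {A B : Finset (Fin N)} (h : A.card ≠ B.card) :
    coactCoeff A B = 0 := by
  have h1 := factorial_smul_coactCoeff (A := A) rfl B
  rw [Finset.sum_eq_zero fun k _ => ?_, map_zero] at h1
  · exact (smul_eq_zero.1 h1).resolve_left (factorial_ne_zero' _)
  · split_ifs with hk
    · by_cases hi : Function.Injective k
      · rw [parity_ofFn_of_injective hi] at hk
        exact absurd (by rw [← hk, Finset.card_image_of_injective _ hi, Finset.card_univ,
          Fintype.card_fin]) h
      · rw [minor_eq_zero _ hi, smul_zero]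
    · rfl

/-- The coefficients of the coaction are the twisted minors. -/
theorem coactCoeff_eq_theta_minor {N r : ℕ} {A B : Finset (Fin N)} (hA : A.card = r)
    (hB : B.card = r) :
    coactCoeff A B = theta N (minor (A.orderEmbOfFin hA) (B.orderEmbOfFin hB)) := by
  have h1 := factorial_smul_coactCoeff hA B
  have h2 : (∑ k : Fin r → Fin N, if parity (List.ofFn k) = B then
      listSign (List.ofFn k) • minor (A.orderEmbOfFin hA) k else 0) =
      (r.factorial : ℂ) • minor (A.orderEmbOfFin hA) (B.orderEmbOfFin hB) := by
    have h3 : (r.factorial : ℂ) • minor (A.orderEmbOfFin hA) (B.orderEmbOfFin hB) =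
        ∑ _σ : Equiv.Perm (Fin r), minor (A.orderEmbOfFin hA) (B.orderEmbOfFin hB) := by
      rw [Finset.sum_const, Finset.card_univ, Fintype.card_perm, Fintype.card_fin,
        Nat.cast_smul_eq_nsmul]
    rw [h3]
    symm
    -- The lists `k` with a nonzero contribution are exactly orderings of `B`; they are parametrised
    -- by permutations of `Fin r`.
    refine Fintype.sum_of_injective
      (fun (σ : Equiv.Perm (Fin r)) t => B.orderEmbOfFin hB (σ t)) ?_ _ _ ?_ ?_
    · intro σ τ h
      ext t : 1
      exact (B.orderEmbOfFin hB).injective (congrFun h t)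
    · intro k hk
      split_ifs with hp
      · by_cases hi : Function.Injective k
        · exact absurd (exists_perm_of_parity_eq hB hi hp) hk
        · rw [minor_eq_zero _ hi, smul_zero]
      · rfl
    -- The sign of the list and the sign from permuting the columns of the minor both equal the sign
    -- of `σ`, so each ordering of `B` contributes the same minor.
    · intro σ
      rw [if_pos (parity_ofFn_comp_perm hB σ), listSign_ofFn_comp_perm, minor_comp_perm,
        Algebra.smul_def, map_intCast, ← mul_assoc, ← Int.cast_mul, ← Units.val_mul,
        Int.units_mul_self, Units.val_one, Int.cast_one, one_mul]
  rw [h2, map_smul] at h1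
  exact smul_right_injective _ (factorial_ne_zero' r) h1

/-! ### The antisymmetric representations -/

/-- The coefficient of a basis vector of the tensor power. -/
noncomputable def tensorCoeff {N r : ℕ} (a : Fin r → Fin N) : TensorPow N r →ₗ[ℂ] ℂ :=
  PiTensorProduct.lift ((MultilinearMap.mkPiAlgebra ℂ (Fin r) ℂ).compLinearMap
    fun t => (LinearMap.proj (a t) : (Fin N → ℂ) →ₗ[ℂ] ℂ))

theorem tensorCoeff_tprod {N r : ℕ} (a : Fin r → Fin N) (v : Fin r → Fin N → ℂ) :
    tensorCoeff a (PiTensorProduct.tprod ℂ v) = ∏ t, v t (a t) := by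
  rw [tensorCoeff, PiTensorProduct.lift.tprod]
  rfl

theorem tensorCoeff_alt {N r : ℕ} (a : Fin r → Fin N) (v : Fin r → Fin N → ℂ) :
    tensorCoeff a (alt N r v) = (Matrix.of fun s t => v s (a t)).det := by
  rw [alt_apply, map_sum, Matrix.det_apply']
  refine Finset.sum_congr rfl fun σ _ => ?_
  rw [map_smul, tensorCoeff_tprod]
  rfl

/-- The index set of the basis of the space of antisymmetric tensors. -/
abbrev RSet (N r : ℕ) : Type := {A : Finset (Fin N) // A.card = r}

/-- The increasing enumeration of a finite set. -/
def RSet.enum {N r : ℕ} (A : RSet N r) : Fin r ↪o Fin N := A.1.orderEmbOfFin A.2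

theorem RSet.range_enum {N r : ℕ} (A : RSet N r) : Set.range A.enum = A.1 :=
  Finset.range_orderEmbOfFin _ _

/-- If two sets of the same size differ, some element of `B` lies outside `A`, and it gives a zero
row in the determinant. -/
theorem tensorCoeff_xi {N r : ℕ} (A B : RSet N r) :
    tensorCoeff A.enum (xi B.enum) = if A = B then 1 else 0 := by
  rw [xi_eq_alt, tensorCoeff_alt]
  split_ifs with h
  · subst h
    have h1 : (Matrix.of fun s t => (Pi.single (A.enum s) 1 : Fin N → ℂ) (A.enum t)) = 1 := by
      ext s t
      rw [Matrix.of_apply, Pi.single_apply, Matrix.one_apply]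
      exact if_congr (by rw [A.enum.injective.eq_iff, eq_comm]) rfl rfl
    rw [h1, Matrix.det_one]
  · obtain ⟨x, hxB, hxA⟩ : ∃ x ∈ B.1, x ∉ A.1 := by
      by_contra! hc
      exact h (Subtype.ext (Finset.eq_of_subset_of_card_le hc (by rw [A.2, B.2])).symm)
    rw [← Finset.mem_coe, ← B.range_enum] at hxB
    obtain ⟨s, rfl⟩ := hxB
    refine Matrix.det_eq_zero_of_row_eq_zero s fun t => ?_
    rw [Matrix.of_apply, Pi.single_apply, if_neg]
    intro he
    apply hxA
    rw [← he, ← Finset.mem_coe, ← A.range_enum]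
    exact ⟨t, rfl⟩

/-- The basis vectors of the space of antisymmetric tensors. -/
noncomputable def xiVec {N r : ℕ} (A : RSet N r) : antisym N r := ⟨xi A.enum, xi_mem _⟩

theorem linearIndependent_xiVec (N r : ℕ) : LinearIndependent ℂ (xiVec (N := N) (r := r)) := by
  rw [Fintype.linearIndependent_iffₛ]
  intro c c' hc A
  have h := congrArg (fun x : antisym N r => tensorCoeff A.enum (x : TensorPow N r)) hc
  simp only [AddSubmonoidClass.coe_finsetSum, Submodule.coe_smul, map_sum, map_smul]
    at h
  have h2 : ∀ B : RSet N r, tensorCoeff A.enum (xiVec B : TensorPow N r) =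
      if A = B then 1 else 0 := tensorCoeff_xi A
  simpa [h2] using h

theorem span_xiVec (N r : ℕ) : ⊤ ≤ Submodule.span ℂ (Set.range (xiVec (N := N) (r := r))) := by
  rintro ⟨x, hx'⟩ -
  have hx := hx'
  rw [antisym] at hx
  -- Increasing sequences correspond to `r`-element subsets through their images.
  have h : Set.range (fun i : Fin r ↪o Fin N => xi i) =
      (antisym N r).subtype '' Set.range (xiVec (N := N) (r := r)) := by
    ext y
    constructor
    · rintro ⟨i, rfl⟩
      let A : RSet N r := ⟨Finset.univ.image i, by
        rw [Finset.card_image_of_injective _ i.injective, Finset.card_univ, Fintype.card_fin]⟩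
      refine ⟨xiVec A, ⟨A, rfl⟩, ?_⟩
      have he : A.enum = i := by
        apply DFunLike.ext'
        exact (Finset.orderEmbOfFin_unique A.2 (fun t => Finset.mem_image_of_mem _
          (Finset.mem_univ t)) i.strictMono).symm
      change xi A.enum = xi i
      rw [he]
    · rintro ⟨_, ⟨A, rfl⟩, rfl⟩
      exact ⟨A.enum, rfl⟩
  rw [h, Submodule.span_image] at hx
  obtain ⟨y, hy, hyx⟩ := hx
  have : y = ⟨x, hx'⟩ := Subtype.ext hyx
  rwa [← this]

/-- The basis of the space of antisymmetric tensors. -/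
noncomputable def xiBasis (N r : ℕ) : Module.Basis (RSet N r) ℂ (antisym N r) :=
  Module.Basis.mk (linearIndependent_xiVec N r) (span_xiVec N r)

theorem xiBasis_apply {N r : ℕ} (A : RSet N r) : xiBasis N r A = xiVec A :=
  Module.Basis.mk_apply _ _ _

/-- By `tensorCoeff_xi`, the coefficients at increasing indices form the dual basis. -/
theorem xiBasis_repr {N r : ℕ} (x : antisym N r) (A : RSet N r) :
    (xiBasis N r).repr x A = tensorCoeff A.enum (x : TensorPow N r) := by
  have h : (xiBasis N r).coord A = tensorCoeff A.enum ∘ₗ (antisym N r).subtype := by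
    refine (xiBasis N r).ext fun B => ?_
    rw [Module.Basis.coord_apply, Module.Basis.repr_self, xiBasis_apply]
    refine Eq.trans ?_ (tensorCoeff_xi A B).symm
    rw [Finsupp.single_apply]
    exact if_congr eq_comm rfl rfl
  exact LinearMap.congr_fun h x

theorem tensorRep_xi {N r : ℕ} (g : O N) (i : Fin r → Fin N) :
    tensorRep N r g (xi i) = alt N r fun k => stdAct g (Pi.single (i k) 1) := by
  rw [alt_apply, xi, map_sum]
  refine Finset.sum_congr rfl fun σ _ => ?_
  rw [map_smul]
  congr 1
  exact PiTensorProduct.map_tprod _ _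

theorem evalHom_minor {N r : ℕ} (g : O N) (a b : Fin r → Fin N) : evalHom g (minor a b) =
    (Matrix.of fun s t => ((g : Matrix (Fin N) (Fin N) ℝ) (a s) (b t) : ℂ)).det := by
  rw [minor_eq_sum, map_sum, Matrix.det_apply']
  refine Finset.sum_congr rfl fun σ _ => ?_
  rw [map_smul, map_wordProd, wordProd_word, List.prod_ofFn]
  rfl

/-- The matrix coefficients of the antisymmetric representations are the minors. -/
theorem toMatrix_antisymRep {N r : ℕ} (g : O N) (A B : RSet N r) :
    LinearMap.toMatrix (xiBasis N r) (xiBasis N r) (antisymRep N r g) A B =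
      evalO (minor A.enum B.enum) g := by
  rw [LinearMap.toMatrix_apply, xiBasis_repr, xiBasis_apply]
  have h : ((antisymRep N r g (xiVec B) : antisym N r) : TensorPow N r) =
      tensorRep N r g (xi B.enum) := rfl
  rw [h, tensorRep_xi, tensorCoeff_alt, ← evalHom_apply, evalHom_minor, ← Matrix.det_transpose]
  congr 1
  ext s t
  simp [stdAct, Matrix.toLin'_apply]

theorem magicComponent_eq {N r : ℕ} : magicComponent N r =
    (Matrix.of fun A B : RSet N r => minor A.enum B.enum).map (theta N) :=
  Matrix.ext fun A B => coactCoeff_eq_theta_minor A.2 B.2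

theorem corresponds_antisymRep (N r : ℕ) :
    Corresponds (theta N) (antisymRep N r) (magicComponent N r) :=
  ⟨xiBasis N r, Matrix.of fun A B : RSet N r => minor A.enum B.enum, toMatrix_antisymRep,
    magicComponent_eq.symm⟩

/-- A matrix of functions which represents a representation in some basis. -/
theorem isRep_of_toMatrix {N : ℕ} {V : Type*} [AddCommMonoid V] [Module ℂ V]
    {ρ : Representation ℂ (O N) V} {n : Type*} [Fintype n] [DecidableEq n]
    {b : Module.Basis n ℂ V} {c : Matrix n n (PolO N)}
    (h : ∀ g i j, LinearMap.toMatrix b b (ρ g) i j = evalO (c i j) g) : IsRep c where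
  mul g g' i j := by
    simp only [← h]
    rw [map_mul, Module.End.mul_eq_comp, LinearMap.toMatrix_comp b b b, Matrix.mul_apply]
  one i j := by
    rw [← h, map_one, LinearMap.toMatrix_one, Matrix.one_apply]

theorem Corresponds.isCorep {N : ℕ} {Δ : PolObar N →ₐ[ℂ] PolObar N ⊗[ℂ] PolObar N}
    (hΔ : ∀ x, ∀ g h : O N, evalBar₂ g h (Δ x) = evalBar (g * h) x)
    {V : Type*} [AddCommMonoid V] [Module ℂ V]
    {ρ : Representation ℂ (O N) V} {n : Type*} [Fintype n] [DecidableEq n]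
    {w : Matrix n n (PolObar N)} (h : Corresponds (theta N) ρ w) :
    IsCorep Δ (counitBar N) w := by
  obtain ⟨b, c, hc, rfl⟩ := h
  exact (isRep_iff_isCorep hΔ c).1 (isRep_of_toMatrix hc)

/-! ### The full antisymmetric representation -/

/-- The basis of the space of the full antisymmetric representation. -/
noncomputable def fullBasis (N : ℕ) : Module.Basis (Σ r : Fin (N + 1), RSet N (r : ℕ)) ℂ
    (⨁ r : Fin (N + 1), antisym N (r : ℕ)) :=
  DFinsupp.basis fun r : Fin (N + 1) => xiBasis N (r : ℕ)

theorem fullBasis_repr {N : ℕ} (x : ⨁ r : Fin (N + 1), antisym N (r : ℕ))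
    (p : Σ r : Fin (N + 1), RSet N (r : ℕ)) :
    (fullBasis N).repr x p = (xiBasis N p.1).repr (x p.1) p.2 := rfl

theorem fullBasis_apply {N : ℕ} (p : Σ r : Fin (N + 1), RSet N (r : ℕ)) :
    fullBasis N p = DirectSum.lof ℂ (Fin (N + 1)) (fun r => antisym N (r : ℕ)) p.1
      (xiBasis N p.1 p.2) := by
  apply (fullBasis N).repr.injective
  ext q
  rw [Module.Basis.repr_self, fullBasis_repr]
  obtain ⟨r, A⟩ := p
  obtain ⟨s, B⟩ := q
  by_cases h : r = s
  · subst h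
    rw [DirectSum.lof_apply, Module.Basis.repr_self, Finsupp.single_apply, Finsupp.single_apply]
    exact if_congr (by simp) rfl rfl
  · rw [Finsupp.single_apply, if_neg (fun h' => h (congrArg Sigma.fst h'))]
    rw [DirectSum.lof_eq_of, DirectSum.of_eq_of_ne _ _ _ (Ne.symm h)]
    simp

/-- Off the diagonal blocks both sides vanish: the action preserves degrees on the left, and
`coactCoeff_eq_zero` applies on the right. -/
theorem toMatrix_fullAntisymRep {N : ℕ} (g : O N) (p q : Σ r : Fin (N + 1), RSet N (r : ℕ)) :
    LinearMap.toMatrix (fullBasis N) (fullBasis N) (fullAntisymRep N g) p q =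
      evalO ((theta N).symm (coactCoeff p.2.1 q.2.1)) g := by
  rw [LinearMap.toMatrix_apply, fullBasis_repr, fullBasis_apply]
  have h : fullAntisymRep N g (DirectSum.lof ℂ (Fin (N + 1)) (fun r => antisym N (r : ℕ)) q.1
      (xiBasis N q.1 q.2)) = DirectSum.lof ℂ (Fin (N + 1)) (fun r => antisym N (r : ℕ)) q.1
      (antisymRep N q.1 g (xiBasis N q.1 q.2)) := DirectSum.lmap_lof _ _ _
  rw [h]
  obtain ⟨r, A⟩ := p
  obtain ⟨s, B⟩ := q
  by_cases h : r = s
  · subst h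
    rw [DirectSum.lof_apply, ← LinearMap.toMatrix_apply, toMatrix_antisymRep,
      coactCoeff_eq_theta_minor A.2 B.2, LinearEquiv.symm_apply_apply]
    rfl
  · rw [coactCoeff_eq_zero (by rw [A.2, B.2]; exact fun h' => h (Fin.ext h')), map_zero,
      DirectSum.lof_eq_of, DirectSum.of_eq_of_ne _ _ _ h]
    simp [evalO]

/-- Subsets as elements of the cube. -/
noncomputable def cubeEquiv (N : ℕ) : Finset (Fin N) ≃ Cube N :=
  Equiv.ofBijective cubeElt ((Fintype.bijective_iff_injective_and_card _).2
    ⟨cubeElt_injective, by simp [Cube]⟩)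

theorem cubeEquiv_apply {N : ℕ} (A : Finset (Fin N)) : cubeEquiv N A = cubeElt A := rfl

/-- The disjoint union of the sets of subsets of a given size. -/
def sigmaRSetEquiv (N : ℕ) : (Σ r : Fin (N + 1), RSet N (r : ℕ)) ≃ Finset (Fin N) where
  toFun p := p.2.1
  invFun A := ⟨⟨A.card, Nat.lt_succ_of_le (by simpa using A.card_le_univ)⟩, A, rfl⟩
  left_inv := by
    rintro ⟨⟨r, hr⟩, A, hA⟩
    dsimp at hA
    subst hA
    rfl
  right_inv _ := rfl

/-- The basis of the full antisymmetric representation, indexed by the cube. -/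
noncomputable def cubeBasis (N : ℕ) :
    Module.Basis (Cube N) ℂ (⨁ r : Fin (N + 1), antisym N (r : ℕ)) :=
  (fullBasis N).reindex ((sigmaRSetEquiv N).trans (cubeEquiv N))

/-- The coefficients of the coaction, indexed by the cube. -/
noncomputable def cubeMat (N : ℕ) : Matrix (Cube N) (Cube N) (PolObar N) :=
  Matrix.of fun i j => coactCoeff ((cubeEquiv N).symm i) ((cubeEquiv N).symm j)

theorem toMatrix_cubeBasis {N : ℕ} (g : O N) (i j : Cube N) :
    LinearMap.toMatrix (cubeBasis N) (cubeBasis N) (fullAntisymRep N g) i j =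
      evalO ((theta N).symm (cubeMat N i j)) g := by
  rw [LinearMap.toMatrix_apply, cubeBasis, Module.Basis.repr_reindex_apply,
    Module.Basis.reindex_apply, ← LinearMap.toMatrix_apply, toMatrix_fullAntisymRep]
  rfl

/-! ### The Fourier transform -/

theorem pairing_eq_prod {N : ℕ} (i j : Cube N) : pairing i j = ∏ k,
    (-1 : ℂ) ^ ((Multiplicative.toAdd (i k)).val * (Multiplicative.toAdd (j k)).val) := by
  rw [pairing, Finset.prod_pow_eq_pow_sum]

theorem neg_one_pow_val_add (x y z : ZMod 2) :
    (-1 : ℂ) ^ ((x + y).val * z.val) = (-1) ^ (x.val * z.val) * (-1) ^ (y.val * z.val) := by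
  have h : ∀ w : ZMod 2, w = 0 ∨ w = 1 := by decide
  have h2 : (1 + 1 : ZMod 2) = 0 := rfl
  rcases h x with rfl | rfl <;> rcases h y with rfl | rfl <;> simp [h2, ZMod.val_one, ← mul_pow]

theorem sum_neg_one_pow_val (x z : ZMod 2) :
    ∑ y : ZMod 2, (-1 : ℂ) ^ (x.val * y.val) * (-1) ^ (y.val * z.val) =
      if x = z then 2 else 0 := by
  rw [show (Finset.univ : Finset (ZMod 2)) = {0, 1} from rfl, Finset.sum_pair (by decide)]
  have h : ∀ w : ZMod 2, w = 0 ∨ w = 1 := by decide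
  rcases h x with rfl | rfl <;> rcases h z with rfl | rfl <;> norm_num [ZMod.val_one]

theorem pairing_mul {N : ℕ} (i j k : Cube N) : pairing (i * j) k = pairing i k * pairing j k := by
  simp only [pairing_eq_prod, ← Finset.prod_mul_distrib]
  exact Finset.prod_congr rfl fun a _ => neg_one_pow_val_add _ _ _

theorem pairing_comm {N : ℕ} (i j : Cube N) : pairing i j = pairing j i := by
  simp only [pairing_eq_prod, mul_comm]

theorem pairing_one {N : ℕ} (k : Cube N) : pairing 1 k = 1 := by
  simp [pairing]

theorem pairing_mul_self {N : ℕ} (i j : Cube N) : pairing i j * pairing i j = 1 := by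
  rw [pairing, ← mul_pow]; norm_num

theorem star_pairing {N : ℕ} (i j : Cube N) : star (pairing i j) = pairing i j := by
  simp [pairing]

/-- The sum factors over coordinates, and a coordinate where `i` and `k` differ gives the factor
`0`. -/
theorem sum_pairing_mul {N : ℕ} (i k : Cube N) :
    ∑ j, pairing i j * pairing j k = if i = k then (2 : ℂ) ^ N else 0 := by
  simp only [pairing_eq_prod, ← Finset.prod_mul_distrib]
  rw [← Fintype.prod_sum fun (a : Fin N) (y : Multiplicative (ZMod 2)) =>
    (-1 : ℂ) ^ ((Multiplicative.toAdd (i a)).val * (Multiplicative.toAdd y).val) *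
    (-1) ^ ((Multiplicative.toAdd y).val * (Multiplicative.toAdd (k a)).val)]
  have h : ∀ a, ∑ y : Multiplicative (ZMod 2),
      (-1 : ℂ) ^ ((Multiplicative.toAdd (i a)).val * (Multiplicative.toAdd y).val) *
      (-1) ^ ((Multiplicative.toAdd y).val * (Multiplicative.toAdd (k a)).val) =
      if i a = k a then 2 else 0 := fun a => sum_neg_one_pow_val _ _
  simp only [h]
  split_ifs with hik
  · simp [hik]
  · obtain ⟨a, ha⟩ := Function.ne_iff.1 hik
    exact Finset.prod_eq_zero (Finset.mem_univ a) (if_neg ha)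

/-! ### The magic representation -/

/-- The character of the group algebra of the cube given by a vertex. -/
noncomputable def cubeChar {N : ℕ} (k : Cube N) : MonoidAlgebra ℂ (Cube N) →ₐ[ℂ] ℂ :=
  MonoidAlgebra.lift ℂ ℂ (Cube N)
    { toFun := fun i => pairing i k
      map_one' := pairing_one k
      map_mul' := fun i j => pairing_mul i j k }

theorem cubeChar_of {N : ℕ} (i k : Cube N) :
    cubeChar k (MonoidAlgebra.of ℂ (Cube N) i) = pairing i k := by
  rw [cubeChar, MonoidAlgebra.lift_of]
  rfl

/-- The evaluation of the coaction at a vertex of the cube. -/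
noncomputable def vertexEval {N : ℕ} (k : Cube N) :
    PolObar N ⊗[ℂ] MonoidAlgebra ℂ (Cube N) →ₐ[ℂ] PolObar N :=
  (Algebra.TensorProduct.rid ℂ ℂ (PolObar N)).toAlgHom.comp
    (Algebra.TensorProduct.map (AlgHom.id ℂ (PolObar N)) (cubeChar k))

theorem vertexEval_tmul {N : ℕ} (k : Cube N) (x : PolObar N) (y : MonoidAlgebra ℂ (Cube N)) :
    vertexEval k (x ⊗ₜ y) = cubeChar k y • x := rfl

/-- Evaluation at a vertex after the inverse Fourier transform is a character, hence multiplicative.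
This makes `magic N i k` the image of an idempotent under a morphism of algebras. -/
theorem proj_fourierInv {N : ℕ} (k : Cube N) (y : MonoidAlgebra ℂ (Cube N)) :
    fourierInv N y k = cubeChar k y := by
  have h : (LinearMap.proj k : (Cube N → ℂ) →ₗ[ℂ] ℂ) ∘ₗ fourierInv N =
      (cubeChar k).toLinearMap := by
    ext i
    change ∑ j, (Finsupp.single i (1 : ℂ)) j * pairing j k =
      cubeChar k (MonoidAlgebra.of ℂ (Cube N) i)
    rw [cubeChar_of]
    simp [Finsupp.single_apply]
  exact LinearMap.congr_fun h y

theorem magic_eq_vertexEval {N : ℕ} (i k : Cube N) :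
    magic N i k = vertexEval k (coaction N (fourier N (Pi.single i 1))) := by
  have h : ∀ z : PolObar N ⊗[ℂ] MonoidAlgebra ℂ (Cube N),
      TensorProduct.rid ℂ (PolObar N) ((LinearMap.proj k : (Cube N → ℂ) →ₗ[ℂ] ℂ).lTensor
        (PolObar N) ((fourierInv N).lTensor (PolObar N) z)) = vertexEval k z := by
    intro z
    induction z using TensorProduct.induction_on with
    | zero => simp only [map_zero]
    | tmul x y =>
      rw [vertexEval_tmul, ← proj_fourierInv]
      rfl
    | add z z' h h' => simp only [map_add, h, h']
  exact h _

theorem fourier_single {N : ℕ} (i : Cube N) : fourier N (Pi.single i 1) =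
    ((2 : ℂ) ^ N)⁻¹ • ∑ j, pairing i j • MonoidAlgebra.of ℂ (Cube N) j := by
  change ∑ i', ∑ j, ((Pi.single i 1 : Cube N → ℂ) i' * ((2 : ℂ) ^ N)⁻¹ * pairing i' j) •
    MonoidAlgebra.of ℂ (Cube N) j = _
  rw [Finset.sum_eq_single i (fun i' _ h => by simp [h]) (by simp), Finset.smul_sum]
  refine Finset.sum_congr rfl fun j _ => ?_
  rw [Pi.single_eq_same, one_mul, mul_smul]

/-- Reindexing the sum by translation by `j` shows that the transform of `δ_i` is an eigenvector for
multiplication by group elements, from which its idempotency follows. -/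
theorem fourier_single_mul_of {N : ℕ} (i j : Cube N) :
    fourier N (Pi.single i 1) * MonoidAlgebra.of ℂ (Cube N) j =
      pairing i j • fourier N (Pi.single i 1) := by
  rw [fourier_single, smul_mul_assoc, Finset.sum_mul, smul_comm (pairing i j),
    Finset.smul_sum (r := pairing i j)]
  congr 1
  refine Fintype.sum_equiv (Equiv.mulRight j) _ _ fun l => ?_
  rw [smul_mul_assoc, ← map_mul, Equiv.coe_mulRight, smul_smul, pairing_comm i (l * j),
    pairing_mul, pairing_comm l, pairing_comm j]
  congr 1
  linear_combination -pairing i l * pairing_mul_self i j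

theorem fourier_single_mul_self {N : ℕ} (i : Cube N) :
    fourier N (Pi.single i 1) * fourier N (Pi.single i 1) = fourier N (Pi.single i 1) := by
  conv_lhs => enter [2]; rw [fourier_single]
  rw [mul_smul_comm, Finset.mul_sum]
  simp only [mul_smul_comm, fourier_single_mul_of, smul_smul, pairing_mul_self, one_smul]
  rw [Finset.sum_const, Finset.card_univ, ← Nat.cast_smul_eq_nsmul ℂ, smul_smul]
  have h : (Fintype.card (Cube N) : ℂ) = (2 : ℂ) ^ N := by simp [Cube]
  rw [h, inv_mul_cancel₀ (pow_ne_zero _ two_ne_zero), one_smul]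

theorem sum_pairing {N : ℕ} (j : Cube N) :
    ∑ i, pairing i j = if 1 = j then (2 : ℂ) ^ N else 0 := by
  rw [← sum_pairing_mul]
  simp [pairing_one]

theorem sum_fourier_single (N : ℕ) : ∑ i : Cube N, fourier N (Pi.single i 1) = 1 := by
  simp only [fourier_single]
  rw [← Finset.smul_sum, Finset.sum_comm]
  simp only [← Finset.sum_smul, sum_pairing, ite_smul, zero_smul]
  rw [Finset.sum_ite_eq, if_pos (Finset.mem_univ _), smul_smul,
    inv_mul_cancel₀ (pow_ne_zero _ two_ne_zero), one_smul, map_one]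

theorem vertexEval_eq_sum {N : ℕ} (k : Cube N) (z : PolObar N ⊗[ℂ] MonoidAlgebra ℂ (Cube N)) :
    vertexEval k z = ∑ l, pairing l k • cubeCoeff l z := by
  induction z using TensorProduct.induction_on with
  | zero => simp only [map_zero, smul_zero, Finset.sum_const_zero]
  | tmul x y =>
    induction y using MonoidAlgebra.induction_on with
    | of i =>
      rw [vertexEval_tmul, cubeChar_of]
      simp only [cubeCoeff_tmul_of, smul_ite, smul_zero]
      rw [Finset.sum_ite_eq, if_pos (Finset.mem_univ _)]
    | add y y' h h' =>
      simp only [TensorProduct.tmul_add, map_add, h, h', smul_add, Finset.sum_add_distrib]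
    | smul c y h =>
      simp only [TensorProduct.tmul_smul, map_smul, h, Finset.smul_sum]
      exact Finset.sum_congr rfl fun l _ => smul_comm _ _ _
  | add z z' h h' => simp only [map_add, h, h', smul_add, Finset.sum_add_distrib]

theorem cubeCoeff_coaction {N : ℕ} (j l : Cube N) :
    cubeCoeff l (coaction N (MonoidAlgebra.of ℂ (Cube N) j)) = cubeMat N j l := by
  obtain ⟨A, rfl⟩ := (cubeEquiv N).surjective j
  obtain ⟨B, rfl⟩ := (cubeEquiv N).surjective l
  rw [cubeMat, Matrix.of_apply, Equiv.symm_apply_apply, Equiv.symm_apply_apply]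
  rfl

/-- The magic representation is the Fourier transform of the matrix of the coaction. -/
theorem magic_apply {N : ℕ} (i k : Cube N) : magic N i k =
    ((2 : ℂ) ^ N)⁻¹ • ∑ j, ∑ l, (pairing i j * pairing l k) • cubeMat N j l := by
  rw [magic_eq_vertexEval, fourier_single, map_smul, map_smul, map_sum, map_sum]
  congr 1
  refine Finset.sum_congr rfl fun j _ => ?_
  rw [map_smul, map_smul, vertexEval_eq_sum, Finset.smul_sum]
  refine Finset.sum_congr rfl fun l _ => ?_
  rw [cubeCoeff_coaction, smul_smul]

theorem vertexEval_gen {N : ℕ} (k : Cube N) (a : Fin N) :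
    vertexEval k (coaction N (MonoidAlgebra.of ℂ (Cube N) (cubeElt {a}))) =
      ∑ b, pairing (cubeElt {b}) k • ubar N a b := by
  rw [coaction_gen, map_sum]
  refine Finset.sum_congr rfl fun b _ => ?_
  rw [vertexEval_tmul, cubeChar_of]

/-- The image of a generator is a real combination of self-adjoint coordinates. Images of group
elements commute, the group algebra of the cube being commutative, so their products stay
self-adjoint. -/
theorem star_vertexEval {N : ℕ} (k j : Cube N) :
    star (vertexEval k (coaction N (MonoidAlgebra.of ℂ (Cube N) j))) =
      vertexEval k (coaction N (MonoidAlgebra.of ℂ (Cube N) j)) := by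
  obtain ⟨A, rfl⟩ := (cubeEquiv N).surjective j
  rw [cubeEquiv_apply]
  induction A using Finset.induction_on with
  | empty => rw [cubeElt_empty, map_one, map_one, map_one, star_one]
  | insert a A ha ih =>
    have h : cubeElt (insert a A) = cubeElt {a} * cubeElt A := by
      rw [← cubeElt_symmDiff, (Finset.disjoint_singleton_left.2 ha).symmDiff_eq_sup]
      rfl
    have h2 : star (vertexEval k (coaction N (MonoidAlgebra.of ℂ (Cube N) (cubeElt {a})))) =
        vertexEval k (coaction N (MonoidAlgebra.of ℂ (Cube N) (cubeElt {a}))) := by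
      rw [vertexEval_gen, star_sum]
      refine Finset.sum_congr rfl fun b _ => ?_
      rw [star_smul, star_pairing, (isTwistedOrthogonal_ubar N).selfAdjoint]
    rw [h, map_mul, map_mul, map_mul, star_mul, ih, h2, ← map_mul, ← map_mul, mul_comm, map_mul,
      map_mul]

theorem cubeMat_one {N : ℕ} (j : Cube N) : cubeMat N j 1 = if j = 1 then 1 else 0 := by
  obtain ⟨A, rfl⟩ := (cubeEquiv N).surjective j
  rw [← cubeCoeff_coaction]
  split_ifs with h
  · rw [h, map_one, map_one]
    have h1 := cubeCoeff_tmul_of (N := N) 1 1 1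
    rwa [if_pos rfl] at h1
  · have hA : A ≠ ∅ := fun hA => h (by rw [hA]; rfl)
    exact coactCoeff_eq_zero (A := A) (B := ∅) (by
      rw [Finset.card_empty]
      exact Finset.card_ne_zero.2 (Finset.nonempty_iff_ne_empty.2 hA))

theorem isMagicUnitary_magic (N : ℕ) : IsMagicUnitary (magic N) where
  selfAdjoint i k := by
    rw [magic_eq_vertexEval, fourier_single, map_smul, map_smul, map_sum, map_sum, star_smul,
      star_sum]
    have h : star ((2 : ℂ) ^ N)⁻¹ = ((2 : ℂ) ^ N)⁻¹ := by simp
    rw [h]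
    congr 1
    refine Finset.sum_congr rfl fun j _ => ?_
    rw [map_smul, map_smul, star_smul, star_pairing, star_vertexEval]
  idempotent i k := by
    rw [magic_eq_vertexEval, ← map_mul, ← map_mul, fourier_single_mul_self]
  -- Summing the pairing over the vertices `k` keeps only the coefficient of the group element `1`,
  -- and this coefficient vanishes in `Φ(g_A)` for nonempty `A`, by degree.
  row_sum i := by
    simp only [magic_apply]
    rw [← Finset.smul_sum, Finset.sum_comm]
    have h : ∀ j, ∑ k, ∑ l, (pairing i j * pairing l k) • cubeMat N j l =
        if j = 1 then (2 : ℂ) ^ N • 1 else 0 := by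
      intro j
      rw [Finset.sum_comm]
      have h1 : ∀ l : Cube N, ∑ k, pairing l k = if 1 = l then (2 : ℂ) ^ N else 0 := fun l => by
        rw [← sum_pairing]
        exact Finset.sum_congr rfl fun k _ => pairing_comm l k
      simp only [← Finset.sum_smul, ← Finset.mul_sum, h1, mul_ite, mul_zero, ite_smul, zero_smul]
      rw [Finset.sum_ite_eq, if_pos (Finset.mem_univ _), cubeMat_one]
      split_ifs with hj
      · rw [hj, pairing_comm, pairing_one, one_mul]
      · rw [smul_zero]
    simp only [h]
    rw [Finset.sum_ite_eq', if_pos (Finset.mem_univ _), smul_smul,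
      inv_mul_cancel₀ (pow_ne_zero _ two_ne_zero), one_smul]
  -- The functions `δ_i` add up to `1`, and the coaction and `vertexEval` are unital.
  col_sum k := by
    simp only [magic_eq_vertexEval]
    rw [← map_sum, ← map_sum, sum_fourier_single, map_one, map_one]

/-- The matrix of the Fourier transform on the cube. -/
noncomputable def pairingMat (N : ℕ) : Matrix (Cube N) (Cube N) ℂ := Matrix.of pairing

theorem pairingMat_mul_self (N : ℕ) : pairingMat N * pairingMat N = (2 : ℂ) ^ N • 1 := by
  ext i k
  rw [Matrix.mul_apply, Matrix.smul_apply, Matrix.one_apply, smul_ite, smul_zero, smul_eq_mul,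
    mul_one]
  exact sum_pairing_mul i k

theorem inv_smul_pairingMat_mul (N : ℕ) :
    (((2 : ℂ) ^ N)⁻¹ • pairingMat N) * pairingMat N = 1 := by
  rw [Matrix.smul_mul, pairingMat_mul_self, smul_smul,
    inv_mul_cancel₀ (pow_ne_zero _ two_ne_zero), one_smul]

theorem pairingMat_mul_inv_smul (N : ℕ) :
    pairingMat N * (((2 : ℂ) ^ N)⁻¹ • pairingMat N) = 1 := by
  rw [Matrix.mul_smul, pairingMat_mul_self, smul_smul,
    inv_mul_cancel₀ (pow_ne_zero _ two_ne_zero), one_smul]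

/-- The basis of the full antisymmetric representation in which it corresponds to the magic
representation. -/
noncomputable def magicBasis (N : ℕ) :
    Module.Basis (Cube N) ℂ (⨁ r : Fin (N + 1), antisym N (r : ℕ)) :=
  (cubeBasis N).map (Matrix.toLinOfInv (cubeBasis N) (cubeBasis N) (inv_smul_pairingMat_mul N)
    (pairingMat_mul_inv_smul N))

/-- The coordinates of `magicBasis` in `cubeBasis` are the columns of `2^{-N} • pairingMat`, whose
inverse is `pairingMat`; the change of basis is the conjugation found in `magic_apply`. -/
theorem toMatrix_magicBasis {N : ℕ} (g : O N) :
    LinearMap.toMatrix (magicBasis N) (magicBasis N) (fullAntisymRep N g) =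
      pairingMat N * LinearMap.toMatrix (cubeBasis N) (cubeBasis N) (fullAntisymRep N g) *
        (((2 : ℂ) ^ N)⁻¹ • pairingMat N) := by
  rw [← basis_toMatrix_mul_linearMap_toMatrix_mul_basis_toMatrix (magicBasis N) (cubeBasis N)
    (magicBasis N) (cubeBasis N)]
  have h1 : (cubeBasis N).toMatrix (magicBasis N) = ((2 : ℂ) ^ N)⁻¹ • pairingMat N := by
    have h := LinearMap.toMatrix_toLin (cubeBasis N) (cubeBasis N)
      (((2 : ℂ) ^ N)⁻¹ • pairingMat N)
    refine Eq.trans ?_ h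
    ext i j
    rw [LinearMap.toMatrix_apply, Module.Basis.toMatrix_apply]
    rfl
  have h2 : (magicBasis N).toMatrix (cubeBasis N) = pairingMat N := by
    have h := LinearMap.toMatrix_toLin (cubeBasis N) (cubeBasis N) (pairingMat N)
    refine Eq.trans ?_ h
    ext i j
    rw [LinearMap.toMatrix_apply, Module.Basis.toMatrix_apply]
    rfl
  rw [h1, h2]

/-- The magic representation corresponds to the full antisymmetric representation. -/
theorem corresponds_fullAntisymRep (N : ℕ) :
    Corresponds (theta N) (fullAntisymRep N) (magic N) := by
  refine ⟨magicBasis N, (magic N).map (theta N).symm, fun g i k => ?_, ?_⟩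
  · rw [toMatrix_magicBasis, Matrix.map_apply, magic_apply, ← evalHom_apply, map_smul, map_smul,
      Matrix.mul_smul, Matrix.smul_apply]
    congr 1
    rw [Matrix.mul_assoc, Matrix.mul_apply, map_sum, map_sum]
    refine Finset.sum_congr rfl fun j _ => ?_
    rw [Matrix.mul_apply, Finset.mul_sum, map_sum, map_sum]
    refine Finset.sum_congr rfl fun l _ => ?_
    rw [toMatrix_cubeBasis, map_smul, map_smul, evalHom_apply, smul_eq_mul, pairingMat,
      Matrix.of_apply, Matrix.of_apply]
    ring
  · ext1 i k
    rw [Matrix.map_apply, Matrix.map_apply, LinearEquiv.apply_symm_apply]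

/-! ### Characters -/

/-- The permutation of the whole set of indices given by a permutation of the elements of a
subset, listed in increasing order. -/
def extendPerm {N r : ℕ} {A : Finset (Fin N)} (hA : A.card = r) (τ : Equiv.Perm (Fin r)) :
    Equiv.Perm (Fin N) :=
  τ.extendDomain (A.orderIsoOfFin hA).toEquiv

theorem extendPerm_apply {N r : ℕ} {A : Finset (Fin N)} (hA : A.card = r)
    (τ : Equiv.Perm (Fin r)) (t : Fin r) :
    extendPerm hA τ (A.orderEmbOfFin hA t) = A.orderEmbOfFin hA (τ t) :=
  Equiv.Perm.extendDomain_apply_image τ (A.orderIsoOfFin hA).toEquiv t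

theorem sign_extendPerm {N r : ℕ} {A : Finset (Fin N)} (hA : A.card = r)
    (τ : Equiv.Perm (Fin r)) : Equiv.Perm.sign (extendPerm hA τ) = Equiv.Perm.sign τ :=
  Equiv.Perm.sign_extendDomain _ _

theorem extendPerm_mem {N r : ℕ} {A : Finset (Fin N)} (hA : A.card = r)
    (τ : Equiv.Perm (Fin r)) : extendPerm hA τ ∈ permsOn A := by
  rw [permsOn, Finset.mem_filter]
  exact ⟨Finset.mem_univ _, fun a ha => Equiv.Perm.extendDomain_apply_not_subtype τ _ ha⟩

theorem extendPerm_injective {N r : ℕ} {A : Finset (Fin N)} (hA : A.card = r) :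
    Function.Injective (extendPerm hA) :=
  Equiv.Perm.extendDomainHom_injective (A.orderIsoOfFin hA).toEquiv

/-- A permutation fixing every point outside `A` maps `A` to itself, and so restricts to the
enumeration of `A`. -/
theorem exists_extendPerm {N r : ℕ} {A : Finset (Fin N)} (hA : A.card = r)
    {σ : Equiv.Perm (Fin N)} (hσ : σ ∈ permsOn A) : ∃ τ, extendPerm hA τ = σ := by
  rw [permsOn, Finset.mem_filter] at hσ
  have hmem : ∀ a, a ∈ A ↔ σ a ∈ A := by
    intro a
    constructor
    · intro ha
      by_contra h
      have he : σ a = a := σ.injective (hσ.2 _ h)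
      rw [he] at h
      exact h ha
    · intro h
      by_contra ha
      rw [hσ.2 a ha] at h
      exact ha h
  have h1 : ∀ t, ∃ s, A.orderEmbOfFin hA s = σ (A.orderEmbOfFin hA t) := by
    intro t
    have : σ (A.orderEmbOfFin hA t) ∈ Set.range (A.orderEmbOfFin hA) := by
      rw [Finset.range_orderEmbOfFin]
      exact (hmem _).1 (Finset.orderEmbOfFin_mem A hA t)
    exact this
  choose s hs using h1
  have hinj : Function.Injective s := fun x y hxy =>
    (A.orderEmbOfFin hA).injective (σ.injective (by rw [← hs, ← hs, hxy]))
  refine ⟨Equiv.ofBijective s (Finite.injective_iff_bijective.1 hinj), ?_⟩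
  ext1 a
  by_cases ha : a ∈ A
  · rw [← Finset.mem_coe, ← Finset.range_orderEmbOfFin A hA] at ha
    obtain ⟨t, rfl⟩ := ha
    rw [extendPerm_apply, ← hs]
    rfl
  · rw [hσ.2 a ha]
    have h2 := extendPerm_mem hA (Equiv.ofBijective s (Finite.injective_iff_bijective.1 hinj))
    rw [permsOn, Finset.mem_filter] at h2
    exact h2.2 a ha

theorem sum_permsOn {N r : ℕ} {A : Finset (Fin N)} (hA : A.card = r) {M : Type*}
    [AddCommMonoid M] (f : Equiv.Perm (Fin N) → M) :
    ∑ σ ∈ permsOn A, f σ = ∑ τ : Equiv.Perm (Fin r), f (extendPerm hA τ) := by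
  symm
  refine Finset.sum_bij (fun τ _ => extendPerm hA τ) (fun τ _ => extendPerm_mem hA τ)
    (fun _ _ _ _ h => extendPerm_injective hA h) (fun σ hσ => ?_) fun _ _ => rfl
  obtain ⟨τ, hτ⟩ := exists_extendPerm hA hσ
  exact ⟨τ, Finset.mem_univ _, hτ⟩

theorem sort_eq_ofFn {N r : ℕ} {A : Finset (Fin N)} (hA : A.card = r) :
    A.sort (· ≤ ·) = List.ofFn (A.orderEmbOfFin hA) := by
  subst hA
  refine List.ext_getElem (by simp) fun i h1 h2 => ?_
  rw [List.getElem_ofFn]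
  rfl

theorem orderedProd_extendPerm {N r : ℕ} {A : Finset (Fin N)} (hA : A.card = r)
    (τ : Equiv.Perm (Fin r)) : orderedProd A (extendPerm hA τ) =
      wordProd (ubar N) (word (A.orderEmbOfFin hA) fun t => A.orderEmbOfFin hA (τ t)) := by
  rw [orderedProd, sort_eq_ofFn hA, List.map_ofFn, wordProd_word]
  congr 1
  refine congrArg List.ofFn (funext fun t => ?_)
  rw [Function.comp_apply, extendPerm_apply]

theorem prod_extendPerm {N r : ℕ} {A : Finset (Fin N)} (hA : A.card = r)
    (τ : Equiv.Perm (Fin r)) : ∏ a ∈ A, uO N a (extendPerm hA τ a) =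
      wordProd (uO N) (word (A.orderEmbOfFin hA) fun t => A.orderEmbOfFin hA (τ t)) := by
  rw [wordProd_word, List.prod_ofFn, ← Finset.prod_coe_sort,
    ← Equiv.prod_comp (A.orderIsoOfFin hA).toEquiv]
  refine Finset.prod_congr rfl fun t _ => ?_
  rw [← extendPerm_apply]
  rfl

/-- With `A` listed in increasing order, the row indices have no inversions, while the column
indices carry the sign of `σ`. The sign of the word is therefore exactly that of `σ`. -/
theorem theta_sign_smul_prod {N : ℕ} (A : Finset (Fin N)) {σ : Equiv.Perm (Fin N)}
    (hσ : σ ∈ permsOn A) :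
    theta N (((Equiv.Perm.sign σ : ℤ) : ℂ) • ∏ a ∈ A, uO N a (σ a)) = orderedProd A σ := by
  obtain ⟨τ, rfl⟩ := exists_extendPerm (A := A) rfl hσ
  have h := listSign_ofFn_comp_perm (A.orderEmbOfFin rfl) 1
  simp only [Equiv.Perm.one_apply, Equiv.Perm.sign_one, Units.val_one, Int.cast_one] at h
  rw [prod_extendPerm, orderedProd_extendPerm, wordProd_ubar_eq_theta, wordSign_word,
    listSign_ofFn_comp_perm, sign_extendPerm, h, one_mul]

theorem minor_self {N r : ℕ} {A : Finset (Fin N)} (hA : A.card = r) :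
    minor (A.orderEmbOfFin hA) (A.orderEmbOfFin hA) = ∑ σ ∈ permsOn A,
      ((Equiv.Perm.sign σ : ℤ) : ℂ) • ∏ a ∈ A, uO N a (σ a) := by
  rw [sum_permsOn hA, minor, ← Matrix.det_transpose, Matrix.det_apply']
  refine Finset.sum_congr rfl fun τ _ => ?_
  rw [prod_extendPerm, wordProd_word, List.prod_ofFn, sign_extendPerm, Algebra.smul_def,
    map_intCast]
  rfl

theorem coactCoeff_self {N : ℕ} (A : Finset (Fin N)) :
    coactCoeff A A = ∑ σ ∈ permsOn A, orderedProd A σ := by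
  rw [coactCoeff_eq_theta_minor (A := A) (B := A) rfl rfl, minor_self, map_sum]
  exact Finset.sum_congr rfl fun σ hσ => theta_sign_smul_prod A hσ

theorem sum_rSet {N r : ℕ} {M : Type*} [AddCommMonoid M] (f : Finset (Fin N) → M) :
    ∑ A : RSet N r, f A.1 = ∑ A ∈ Finset.univ.powersetCard r, f A :=
  (Finset.sum_subtype _ (fun A => by simp [Finset.mem_powersetCard]) f).symm

theorem trace_magicComponent (N r : ℕ) : (magicComponent N r).trace = chiBar N r := by
  rw [chiBar, Matrix.trace, ← sum_rSet]
  exact Finset.sum_congr rfl fun A _ => coactCoeff_self A.1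

theorem theta_chiO (N r : ℕ) : theta N (chiO N r) = chiBar N r := by
  rw [chiO, chiBar, map_sum]
  refine Finset.sum_congr rfl fun A _ => ?_
  rw [map_sum]
  exact Finset.sum_congr rfl fun σ hσ => theta_sign_smul_prod A hσ

theorem trace_antisymRep {N r : ℕ} (g : O N) :
    LinearMap.trace ℂ _ (antisymRep N r g) = evalO (chiO N r) g := by
  rw [LinearMap.trace_eq_matrix_trace ℂ (xiBasis N r), Matrix.trace, chiO, ← sum_rSet,
    ← evalHom_apply, map_sum]
  refine Finset.sum_congr rfl fun A _ => ?_
  rw [Matrix.diag_apply, toMatrix_antisymRep, ← evalHom_apply]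
  exact congrArg _ (minor_self A.2)

theorem trace_magic (N : ℕ) : (magic N).trace = ∑ r ∈ Finset.range (N + 1), chiBar N r := by
  -- Fourier conjugation preserves the trace, here through the orthogonality relations of the
  -- pairing.
  have h1 : (magic N).trace = ∑ j, cubeMat N j j := by
    rw [Matrix.trace]
    simp only [Matrix.diag_apply, magic_apply]
    rw [← Finset.smul_sum, Finset.sum_comm]
    have h : ∀ j, ∑ i, ∑ l, (pairing i j * pairing l i) • cubeMat N j l =
        (2 : ℂ) ^ N • cubeMat N j j := by
      intro j
      rw [Finset.sum_comm]
      simp only [← Finset.sum_smul, mul_comm (pairing _ j), sum_pairing_mul, ite_smul, zero_smul]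
      rw [Finset.sum_ite_eq', if_pos (Finset.mem_univ _)]
    simp only [h]
    rw [← Finset.smul_sum, smul_smul, inv_mul_cancel₀ (pow_ne_zero _ two_ne_zero), one_smul]
  have h2 : ∑ j, cubeMat N j j = ∑ A : Finset (Fin N), coactCoeff A A :=
    ((cubeEquiv N).symm.sum_comp fun A => coactCoeff A A)
  rw [h1, h2, ← Finset.powerset_univ, Finset.sum_powerset, Finset.card_univ, Fintype.card_fin]
  refine Finset.sum_congr rfl fun r _ => Finset.sum_congr rfl fun A _ => coactCoeff_self A

end TwistedOrth

theorem theorem4p3 (N : ℕ) :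
    ∃ (Δ : PolObar N →ₐ[ℂ] PolObar N ⊗[ℂ] PolObar N) (ε : PolObar N →ₐ[ℂ] ℂ)
      (θ : PolO N ≃ₗ[ℂ] PolObar N),
      -- the quantum group structure of `Ō_N`
      IsComul Δ ∧ IsCounit ε ∧
      -- the twisting correspondence between the representations of `O_N` and of `Ō_N`
      IsTwist θ ∧ (∀ θ' : PolO N ≃ₗ[ℂ] PolObar N, IsTwist θ' → θ' = θ) ∧
      (∀ (n : ℕ) (ρ : Matrix (Fin n) (Fin n) (PolO N)), IsRep ρ ↔ IsCorep Δ ε (ρ.map θ)) ∧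
      (∀ (n m : ℕ) (ρ : Matrix (Fin n) (Fin n) (PolO N)) (τ : Matrix (Fin m) (Fin m) (PolO N)),
        IsRep ρ → IsRep τ → CorepEquiv ((ρ ⊗ₖ τ).map θ) (ρ.map θ ⊗ₖ τ.map θ)) ∧
      -- the magic representation corresponds to the full antisymmetric representation
      IsMagicUnitary (magic N) ∧ IsCorep Δ ε (magic N) ∧
      Corresponds θ (fullAntisymRep N) (magic N) ∧
      -- the same, in each degree
      (∀ A B : Finset (Fin N), A.card ≠ B.card → coactCoeff A B = 0) ∧
      (∀ r ≤ N, IsCorep Δ ε (magicComponent N r) ∧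
        Corresponds θ (antisymRep N r) (magicComponent N r)) ∧
      -- the same, for the characters
      (magic N).trace = ∑ r ∈ Finset.range (N + 1), chiBar N r ∧
      (∀ r ≤ N, (magicComponent N r).trace = chiBar N r ∧
        (∀ g : O N, LinearMap.trace ℂ _ (antisymRep N r g) = evalO (chiO N r) g) ∧
        θ (chiO N r) = chiBar N r) ∧
      (∀ (A : Finset (Fin N)), ∀ σ ∈ permsOn A,
        θ (((Equiv.Perm.sign σ : ℤ) : ℂ) • ∏ a ∈ A, uO N a (σ a)) = orderedProd A σ) := by
  -- All statements about representations use the pointwise description `hΔ'` of the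
  -- comultiplication.
  obtain ⟨Δ, hΔ, hΔ'⟩ := exists_comulHom N
  exact ⟨Δ, counitBar N, theta N, hΔ, isCounit_counitBar N, isTwist_theta N,
    fun θ' h => h.eq_theta, fun n ρ => isRep_iff_isCorep hΔ' ρ,
    fun n m ρ τ hρ hτ => corepEquiv_kronecker hρ hτ, isMagicUnitary_magic N,
    (corresponds_fullAntisymRep N).isCorep hΔ', corresponds_fullAntisymRep N,
    fun A B h => coactCoeff_eq_zero h,
    fun r _ => ⟨(corresponds_antisymRep N r).isCorep hΔ', corresponds_antisymRep N r⟩,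
    trace_magic N,
    fun r _ => ⟨trace_magicComponent N r, trace_antisymRep, theta_chiO N r⟩,
    fun A σ hσ => theta_sign_smul_prod A hσ⟩
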